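/- Let $n,k$ be integers with $0<k\le n-1$. The bandwidth of a matrix $A=(a_{ij})\in\mathbb{C}^{n\times n}$ is $\max\{|j-i| : a_{ij}\neq 0\}$ (and $0$ for $A=0$). Let $\mathcal{N}$ be the real vector space of Hermitian $n\times n$ matrices of bandwidth at most $k$, and let $\mathcal{D}\subset\mathcal{N}$ be the set of derogatory matrices in $\mathcal{N}$, i.e. those having an eigenvalue of geometric multiplicity greater than $1$. Then $\dim_{\mathbb{R}}\mathcal{N}=n(2k+1)-k(k+1)$, and $\mathcal{D}$ has real codimension $3$ in $\mathcal{N}$, in the following sense: there is a nonempty, relatively open subset $\mathcal{R}\subseteq\mathcal{D}$ that is an embedded smooth submanifold of $\mathcal{N}$ of codimension $3$, and the remaining degenerate part $\mathcal{D}\setminus\mathcal{R}$ has Hausdorff dimension strictly less than $\dim_{\mathbb{R}}\mathcal{N}-3$. In particular, the Hausdorff dimension of $\mathcal{D}$ is exactly $\dim_{\mathbb{R}}\mathcal{N}-3$. -/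

import Mathlib

open scoped ContDiff

/- The real vector space of complex matrices carries the norm given by the largest modulus of an
entry. All norms on it are equivalent, so smoothness and Hausdorff dimension do not depend on
this choice. -/
attribute [local instance] Matrix.normedAddCommGroup Matrix.normedSpace

namespace BandedHermitian

/-- The bandwidth of a square matrix: the maximum of `|j - i|` over all `(i, j)` with
`A i j ≠ 0` (and `0` for the zero matrix). -/
noncomputable def bandwidth {n : ℕ} (A : Matrix (Fin n) (Fin n) ℂ) : ℕ := by
  classical
  exact (Finset.univ.filter fun p : Fin n × Fin n => A p.1 p.2 ≠ 0).sup
    fun p => ((p.2 : ℤ) - (p.1 : ℤ)).natAbs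

theorem bandwidth_le_iff {n : ℕ} (A : Matrix (Fin n) (Fin n) ℂ) (k : ℕ) :
    bandwidth A ≤ k ↔ ∀ i j : Fin n, A i j ≠ 0 → ((j : ℤ) - (i : ℤ)).natAbs ≤ k := by
  classical
  simp only [bandwidth, Finset.sup_le_iff, Finset.mem_filter, Finset.mem_univ, true_and,
    Prod.forall]

/-- The real vector space of Hermitian `n × n` matrices of bandwidth (at most) `k`. -/
noncomputable def bandHerm (n k : ℕ) : Submodule ℝ (Matrix (Fin n) (Fin n) ℂ) where
  carrier := {A | A.IsHermitian ∧ bandwidth A ≤ k}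
  zero_mem' := by
    refine ⟨Matrix.isHermitian_zero, (bandwidth_le_iff _ _).2 fun i j h => ?_⟩
    exact absurd rfl h
  add_mem' := by
    rintro A B ⟨hA, hA'⟩ ⟨hB, hB'⟩
    rw [bandwidth_le_iff] at hA' hB'
    refine ⟨hA.add hB, (bandwidth_le_iff _ _).2 fun i j h => ?_⟩
    by_cases hAij : A i j = 0
    · by_cases hBij : B i j = 0
      · exact absurd (by simp [hAij, hBij]) h
      · exact hB' i j hBij
    · exact hA' i j hAij
  smul_mem' := by
    rintro c A ⟨hA, hA'⟩
    rw [bandwidth_le_iff] at hA'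
    refine ⟨?_, (bandwidth_le_iff _ _).2 fun i j h => hA' i j fun h0 => h (by simp [h0])⟩
    change (c • A).conjTranspose = c • A
    rw [Matrix.conjTranspose_smul, hA.eq, star_trivial]

/-- A square matrix is derogatory if it has an eigenvalue of geometric multiplicity
greater than `1`. -/
def IsDerogatory {n : ℕ} (A : Matrix (Fin n) (Fin n) ℂ) : Prop :=
  ∃ μ : ℂ, 1 < Module.finrank ℂ (Module.End.eigenspace (Matrix.toLin' A) μ)

/-- The derogatory matrices, as a subset of the space of Hermitian matrices of bandwidth `k`. -/
def derogatorySet (n k : ℕ) : Set (bandHerm n k) :=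
  {A | IsDerogatory (A : Matrix (Fin n) (Fin n) ℂ)}

/-- `M` is an embedded smooth submanifold of codimension `c` of the normed space `E`: around each
of its points it is the zero set of a smooth submersion to `ℝᶜ`. -/
def IsSmoothSubmanifold {E : Type*} [NormedAddCommGroup E] [NormedSpace ℝ E]
    (c : ℕ) (M : Set E) : Prop :=
  ∀ x ∈ M, ∃ U : Set E, IsOpen U ∧ x ∈ U ∧ ∃ f : E → EuclideanSpace ℝ (Fin c),
    ContDiffOn ℝ ∞ f U ∧ (∀ y ∈ U, Function.Surjective (fderiv ℝ f y)) ∧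
      M ∩ U = {y ∈ U | f y = 0}

/-- The possibly singular subset `M` of the finite-dimensional space `E` has codimension `c`:
a nonempty, relatively open part `R` of `M` is an embedded smooth submanifold of codimension `c`,
and what remains of `M` has dimension strictly less than `dim E - c`, the dimension of `R`. -/
def HasCodimension {E : Type*} [NormedAddCommGroup E] [NormedSpace ℝ E]
    (M : Set E) (c : ℕ) : Prop :=
  ∃ R : Set E, R ⊆ M ∧ R.Nonempty ∧ (∃ V : Set E, IsOpen V ∧ R = M ∩ V) ∧
    IsSmoothSubmanifold c R ∧ dimH (M \ R) + c < Module.finrank ℝ E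

end BandedHermitian

/-!
Let `A₀` have an eigenvalue `s₀` of multiplicity two, and let the columns of the isometry `V` span
the kernel of `A₀ - s₀`. For `(A, s)` near `(A₀, s₀)`, the kernel of `A - s` is two-dimensional if
and only if the compressed resolvent `Vᴴ (A - s + V Vᴴ)⁻¹ V`, a Hermitian `2 × 2` matrix, is `1`.
The trace of this equation determines `s` by the implicit function theorem, and its trace-free part
leaves three real equations on `A`. They are independent if the compression `X ↦ Vᴴ X V` maps the
band matrices onto the Hermitian `2 × 2` matrices, and they describe the derogatory set near `A₀`
if no other eigenvalue of `A₀` is multiple.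

All other derogatory matrices form a set of dimension at most `dim 𝒩 - 4`. On the matrices all of
whose submatrices have prescribed ranks, the Hausdorff dimension is bounded by that of the space of
directions along which these ranks are constant to first order. This space is estimated for
`A - s`, or for `(A - s, A - t)`, and the eigenvalues enter as additional parameters.
* If the compression to a two-dimensional kernel is not onto, then the kernel contains a vector
  whose support has a gap of length `k`. It splits at the gap into kernel vectors of smaller
  principal submatrices, and induction on the size gives five conditions for one parameter.
* A triple eigenvalue imposes five conditions for one parameter, given by a row of the compression
  to a three-dimensional kernel.
* Two double eigenvalues with surjective compressions impose six conditions for two parameters: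
  the anticommutator of `A - s` with a diagonal matrix unit compresses to zero on the kernel of
  `A - s`, but not on that of `A - t`.
-/

namespace BandedHermitian

open Filter Topology Module Matrix

section Dimension

variable {E F : Type*} [NormedAddCommGroup E] [NormedSpace ℝ E] [FiniteDimensional ℝ E]
  [NormedAddCommGroup F] [NormedSpace ℝ F]

theorem exists_antilipschitzWith_restrict_of_injective {f : E → F} {f' : E →L[ℝ] F} {x : E}
    (hf : HasStrictFDerivAt f f' x) (hinj : Function.Injective f') :
    ∃ U ∈ 𝓝 x, ∃ C, AntilipschitzWith C (fun y : U => f y) := by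
  obtain ⟨K, hK, hanti⟩ := f'.toLinearMap.exists_antilipschitzWith (LinearMap.ker_eq_bot.2 hinj)
  have hc : (2 * K)⁻¹ < K⁻¹ :=
    (inv_lt_inv₀ (by positivity) hK).2 (lt_two_mul_self hK)
  obtain ⟨U, hU, happ⟩ := hf.approximates_deriv_on_nhds (Or.inr (by positivity : 0 < (2 * K)⁻¹))
  refine ⟨U, hU, (K⁻¹ - (2 * K)⁻¹)⁻¹, ?_⟩
  convert! (hanti.domRestrict U).add_lipschitzWith happ.lipschitz_sub hc using 1
  ext y
  simp

theorem exists_mem_nhds_dimH_inter_le_finrank_ker {f : E → F} {f' : E →L[ℝ] F} {x : E}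
    (hf : HasStrictFDerivAt f f' x) {T : Set E} (hT : ∀ y ∈ T, f y = f x) :
    ∃ U ∈ 𝓝 x, dimH (T ∩ U) ≤ finrank ℝ f'.ker := by
  obtain ⟨π, hπ⟩ := Submodule.ClosedComplemented.of_finiteDimensional f'.ker
  have hinj : Function.Injective (f'.prod π) := by
    refine (injective_iff_map_eq_zero _).2 fun y hy => ?_
    obtain ⟨hfy, hπy⟩ : f' y = 0 ∧ π y = 0 := Prod.ext_iff.1 hy
    simpa [hπy] using (congrArg Subtype.val (hπ ⟨y, hfy⟩)).symm
  obtain ⟨U, hU, C, hC⟩ := exists_antilipschitzWith_restrict_of_injective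
    (hf.prodMk π.hasStrictFDerivAt) hinj
  have hslice : Isometry fun z : f'.ker => (f x, z) := Isometry.of_dist_eq fun y z => by simp
  refine ⟨U, hU, ?_⟩
  calc dimH (T ∩ U) = dimH (Subtype.val ⁻¹' T : Set U) := by
        rw [← (isometry_subtype_coe (s := U)).dimH_image, Subtype.image_preimage_coe,
          Set.inter_comm]
    _ ≤ dimH ((fun y : U => (f y, π y)) ⁻¹' Set.range fun z : f'.ker => (f x, z)) :=
        dimH_mono fun y hy => ⟨π y, Prod.ext (hT y hy).symm rfl⟩
    _ ≤ dimH (Set.range fun z : f'.ker => (f x, z)) := hC.dimH_preimage_le _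
    _ = finrank ℝ f'.ker := by
        rw [← Set.image_univ, hslice.dimH_image, Real.dimH_univ_eq_finrank]

theorem dimH_le_of_stratification {ι : Type*} [Countable ι] (S : Set E) (σ : E → ι) (d : ℕ)
    (h : ∀ x ∈ S, ∃ (f : E → F) (f' : E →L[ℝ] F), HasStrictFDerivAt f f' x ∧
      finrank ℝ f'.ker ≤ d ∧ ∀ᶠ y in 𝓝 x, y ∈ S → σ y = σ x → f y = f x) :
    dimH S ≤ d := by
  have hS : S = ⋃ i, S ∩ σ ⁻¹' {i} := by ext; simp
  rw [hS, dimH_iUnion]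
  refine iSup_le fun i => ?_
  by_contra! hlt
  obtain ⟨x, ⟨hxS, hxi⟩, hx⟩ := exists_mem_nhdsWithin_lt_dimH_of_lt_dimH hlt
  obtain ⟨f, f', hf, hd, hev⟩ := h x hxS
  obtain ⟨V, hV, hVf⟩ := hev.exists_mem
  obtain ⟨U, hU, hUd⟩ := exists_mem_nhds_dimH_inter_le_finrank_ker hf
    (T := (S ∩ σ ⁻¹' {i}) ∩ V) fun y hy => hVf y hy.2 hy.1.1 (hy.1.2.trans hxi.symm)
  refine (hx _ ?_).not_ge (hUd.trans (Nat.cast_le.2 hd))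
  rw [Set.inter_assoc]
  exact inter_mem_nhdsWithin _ (inter_mem hV hU)

theorem finrank_ker_le_dimH_of_hasStrictFDerivAt [FiniteDimensional ℝ F] {f : E → F}
    {f' : E →L[ℝ] F} {x : E} (hf : HasStrictFDerivAt f f' x) (hf' : f'.range = ⊤) {M : Set E}
    (hM : ∀ᶠ y in 𝓝 x, f y = f x → y ∈ M) :
    finrank ℝ f'.ker ≤ dimH M := by
  have hker := f'.ker_closedComplemented_of_finiteDimensional_range
  set e := hf.implicitToOpenPartialHomeomorphOfComplemented f f' hf' hker
  obtain ⟨p, hp⟩ : ∃ p : E →L[ℝ] f'.ker, ∀ y, e y = (f y, p (y - x)) :=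
    ⟨_, hf.implicitToOpenPartialHomeomorphOfComplemented_apply hf' hker⟩
  have hxe : x ∈ e.source := hf.mem_implicitToOpenPartialHomeomorphOfComplemented_source hf' hker
  have hex : e x = (f x, 0) := by simp [hp]
  have hslice : Tendsto (fun z : f'.ker => (f x, z)) (𝓝 0) (𝓝 (e x)) := by
    rw [hex]
    exact (Continuous.prodMk_right _).tendsto 0
  have himage : (fun y => p (y - x)) '' M ∈ 𝓝 0 := by
    filter_upwards [hslice (e.open_target.mem_nhds (e.map_source hxe)),
      hslice ((e.tendsto_symm hxe) hM)] with z hzt hzM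
    have hez := (hp _).symm.trans (e.right_inv hzt)
    exact ⟨e.symm (f x, z), hzM (congrArg Prod.fst hez), congrArg Prod.snd hez⟩
  have hlip : LipschitzWith (‖p‖₊ * 1) fun y => p (y - x) :=
    p.lipschitz.comp (IsometryEquiv.subRight x).isometry.lipschitz
  exact (Real.dimH_of_mem_nhds himage).symm.trans_le (hlip.dimH_image_le M)

theorem IsSmoothSubmanifold.exists_hasStrictFDerivAt {c : ℕ} {M : Set E}
    (hM : IsSmoothSubmanifold c M) {x : E} (hx : x ∈ M) :
    ∃ (f : E → EuclideanSpace ℝ (Fin c)) (f' : E →L[ℝ] EuclideanSpace ℝ (Fin c)),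
      HasStrictFDerivAt f f' x ∧ f'.range = ⊤ ∧ c + finrank ℝ f'.ker = finrank ℝ E ∧
        ∀ᶠ y in 𝓝 x, f y = f x ↔ y ∈ M := by
  obtain ⟨U, hU, hxU, f, hf, hsurj, hMU⟩ := hM x hx
  have hfx : f x = 0 := (hMU.subset ⟨hx, hxU⟩).2
  have hrange : (fderiv ℝ f x).range = ⊤ := LinearMap.range_eq_top.2 (hsurj x hxU)
  have hrank := (fderiv ℝ f x).toLinearMap.finrank_range_add_finrank_ker
  rw [hrange, finrank_top, finrank_euclideanSpace_fin] at hrank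
  refine ⟨f, fderiv ℝ f x, (hf.contDiffAt (hU.mem_nhds hxU)).hasStrictFDerivAt (by simp),
    hrange, hrank, ?_⟩
  filter_upwards [hU.mem_nhds hxU] with y hy
  rw [hfx]
  exact ⟨fun hfy => (hMU.superset ⟨hy, hfy⟩).1, fun hyM => (hMU.subset ⟨hyM, hy⟩).2⟩

theorem IsSmoothSubmanifold.dimH_add {c : ℕ} {M : Set E} (hM : IsSmoothSubmanifold c M)
    (hne : M.Nonempty) : dimH M + c = finrank ℝ E := by
  apply le_antisymm
  · have hle : dimH M ≤ (finrank ℝ E - c : ℕ) := by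
      refine dimH_le_of_stratification (F := EuclideanSpace ℝ (Fin c)) M (fun _ => ()) _
        fun x hx => ?_
      obtain ⟨f, f', hf, -, hrank, hev⟩ := hM.exists_hasStrictFDerivAt hx
      exact ⟨f, f', hf, Nat.le_sub_of_add_le' hrank.le, hev.mono fun y hy hyM _ => hy.2 hyM⟩
    obtain ⟨x, hx⟩ := hne
    obtain ⟨-, f', -, -, hrank, -⟩ := hM.exists_hasStrictFDerivAt hx
    calc dimH M + c ≤ (finrank ℝ E - c : ℕ) + c := by gcongr
      _ = finrank ℝ E := by rw [← Nat.cast_add, Nat.sub_add_cancel (by lia)]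
  · obtain ⟨x, hx⟩ := hne
    obtain ⟨f, f', hf, hrange, hrank, hev⟩ := hM.exists_hasStrictFDerivAt hx
    rw [← hrank, Nat.cast_add, add_comm]
    gcongr
    exact finrank_ker_le_dimH_of_hasStrictFDerivAt hf hrange (hev.mono fun y hy => hy.1)

theorem HasCodimension.dimH_add {c : ℕ} {M : Set E} (hM : HasCodimension M c) :
    dimH M + c = finrank ℝ E := by
  obtain ⟨R, hRM, hne, -, hR, hlt⟩ := hM
  rw [← Set.union_sdiff_cancel hRM, dimH_union, max_add, hR.dimH_add hne, max_eq_left hlt.le]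

end Dimension

section ConstantRank

theorem exists_reflexive_generalizedInverse {𝕜 V W : Type*} [Field 𝕜] [AddCommGroup V]
    [Module 𝕜 V] [AddCommGroup W] [Module 𝕜 W] (M : V →ₗ[𝕜] W) :
    ∃ B : W →ₗ[𝕜] V, M ∘ₗ B ∘ₗ M = M ∧ B ∘ₗ M ∘ₗ B = B := by
  obtain ⟨s, hs⟩ := M.rangeRestrict.exists_rightInverse_of_surjective M.range_rangeRestrict
  obtain ⟨p, hp⟩ := M.range.subtype.exists_leftInverse_of_injective (by simp)
  have hMs (y : M.range) : M (s y) = y := congrArg Subtype.val (LinearMap.congr_fun hs y)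
  have hpy (y : M.range) : p y = y := LinearMap.congr_fun hp y
  refine ⟨s ∘ₗ p, LinearMap.ext fun x => ?_, LinearMap.ext fun y => ?_⟩
  · simpa [hMs] using congrArg Subtype.val (hpy ⟨M x, x, rfl⟩)
  · simp [hMs, hpy]

/-- A function of `x` that vanishes at the endomorphisms near `a` of the same rank as `a`, where
`b` is a reflexive generalized inverse of `a`. It makes sense in any ring; as usual `Ring.inverse`
is `0` at non-units, but `1 + b * (x - a)` is a unit near `a`. -/
noncomputable def rankDefect {R : Type*} [Ring R] (a b x : R) : R :=
  (1 - a * b) * (x * Ring.inverse (1 + b * (x - a))) * (1 - b * a)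

theorem rankDefect_self {R : Type*} [Ring R] {a b : R} (h : a * b * a = a) :
    rankDefect a b a = 0 := by
  simp [rankDefect, sub_mul, h]

theorem hasStrictFDerivAt_rankDefect {𝕜 R : Type*} [NontriviallyNormedField 𝕜] [NormedRing R]
    [NormedAlgebra 𝕜 R] [HasSummableGeomSeries R] {a b : R} (h : a * b * a = a) :
    HasStrictFDerivAt (rankDefect a b)
      (ContinuousLinearMap.mulLeftRight 𝕜 R (1 - a * b) (1 - b * a)) a := by
  have hlin : HasStrictFDerivAt (fun x => 1 + b * (x - a)) (ContinuousLinearMap.mul 𝕜 R b) a :=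
    ((ContinuousLinearMap.mul 𝕜 R b).hasStrictFDerivAt.comp a
      ((hasStrictFDerivAt_id a).sub_const a)).const_add 1
  have hinv : HasStrictFDerivAt (fun x => Ring.inverse (1 + b * (x - a)))
      ((-ContinuousLinearMap.mulLeftRight 𝕜 R 1 1).comp (ContinuousLinearMap.mul 𝕜 R b)) a := by
    refine HasStrictFDerivAt.comp a (g := Ring.inverse) ?_ hlin
    simpa using hasStrictFDerivAt_ringInverse (𝕜 := 𝕜) (1 : Rˣ)
  have hprod := (ContinuousLinearMap.mulLeftRight 𝕜 R (1 - a * b)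
    (1 - b * a)).hasStrictFDerivAt.comp a ((hasStrictFDerivAt_id a).mul' hinv)
  convert! hprod using 1
  ext1 x
  simp [← mul_assoc, h]

variable {𝕜 V : Type*} [NontriviallyNormedField 𝕜] [NormedAddCommGroup V] [NormedSpace 𝕜 V]
  [FiniteDimensional 𝕜 V]

theorem rankDefect_eq_zero {M₀ B M : V →L[𝕜] V} (h : M₀ * B * M₀ = M₀) (h' : B * M₀ * B = B)
    (hM : IsUnit (1 + B * (M - M₀))) (hrank : finrank 𝕜 M.range ≤ finrank 𝕜 M₀.range) :
    rankDefect M₀ B M = 0 := by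
  set Z := Ring.inverse (1 + B * (M - M₀))
  have hBMZ : B * (M * Z) = B * M₀ := by
    calc B * (M * Z) = (B * M₀ * B * (M - M₀) + B * M₀) * Z := by rw [h']; noncomm_ring
      _ = B * M₀ * ((1 + B * (M - M₀)) * Z) := by noncomm_ring
      _ = B * M₀ := by rw [Ring.mul_inverse_cancel _ hM, mul_one]
  have hker_le : (M * Z).ker ≤ M₀.ker := fun x hx => by
    have hBMx : (B * M₀) x = 0 := by
      rw [← hBMZ]
      exact (congrArg B hx).trans (map_zero B)
    calc M₀ x = (M₀ * (B * M₀)) x := by rw [← mul_assoc, h]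
      _ = M₀ ((B * M₀) x) := rfl
      _ = 0 := by rw [hBMx, map_zero]
  have hrank' : finrank 𝕜 (M * Z).range ≤ finrank 𝕜 M₀.range :=
    (Submodule.finrank_mono (LinearMap.range_comp_le_range _ _)).trans hrank
  have hker : (M * Z).ker = M₀.ker := by
    refine Submodule.eq_of_le_of_finrank_le hker_le ?_
    have hMZ := (M * Z).toLinearMap.finrank_range_add_finrank_ker
    have hM₀ := M₀.toLinearMap.finrank_range_add_finrank_ker
    lia
  have hzero : M * Z * (1 - B * M₀) = 0 := by
    ext1 x
    have hx : (1 - B * M₀) x ∈ M₀.ker := by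
      change (M₀ * (1 - B * M₀)) x = 0
      simp [mul_sub, ← mul_assoc, h]
    exact hker.ge hx
  rw [rankDefect, mul_assoc, hzero, mul_zero]

variable [CompleteSpace 𝕜]

theorem exists_mul_mul_eq_self (M : V →L[𝕜] V) :
    ∃ B : V →L[𝕜] V, M * B * M = M ∧ B * M * B = B := by
  obtain ⟨B, hMBM, hBMB⟩ := exists_reflexive_generalizedInverse M.toLinearMap
  exact ⟨LinearMap.toContinuousLinearMap B, by ext1 x; exact LinearMap.congr_fun hMBM x,
    by ext1 x; exact LinearMap.congr_fun hBMB x⟩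

theorem eventually_rankDefect_eq_zero {M₀ B : V →L[𝕜] V} (h : M₀ * B * M₀ = M₀)
    (h' : B * M₀ * B = B) :
    ∀ᶠ M in 𝓝 M₀, finrank 𝕜 M.range = finrank 𝕜 M₀.range → rankDefect M₀ B M = 0 := by
  have : CompleteSpace V := FiniteDimensional.complete 𝕜 V
  have hc : ContinuousAt (fun M : V →L[𝕜] V => 1 + B * (M - M₀)) M₀ := by fun_prop
  filter_upwards [hc (Units.isOpen.mem_nhds (by simp))] with M hM hrank
  exact rankDefect_eq_zero h h' hM hrank.le

theorem exists_hasStrictFDerivAt_vanishing_of_rank_eq (M₀ : V →L[𝕜] V) :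
    ∃ (φ : (V →L[𝕜] V) → (V →L[𝕜] V)) (φ' : (V →L[𝕜] V) →L[𝕜] (V →L[𝕜] V)),
      HasStrictFDerivAt φ φ' M₀ ∧ φ M₀ = 0 ∧
      (∀ᶠ M in 𝓝 M₀, finrank 𝕜 M.range = finrank 𝕜 M₀.range → φ M = 0) ∧
      ∀ X, φ' X = 0 → ∀ (v : V) (ψ : V →ₗ[𝕜] 𝕜), M₀ v = 0 → (∀ y, ψ (M₀ y) = 0) → ψ (X v) = 0 := by
  have : CompleteSpace V := FiniteDimensional.complete 𝕜 V
  obtain ⟨B, h, h'⟩ := exists_mul_mul_eq_self M₀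
  refine ⟨rankDefect M₀ B, _, hasStrictFDerivAt_rankDefect h, rankDefect_self h,
    eventually_rankDefect_eq_zero h h', fun X hX v ψ hv hψ => ?_⟩
  simpa [hv, hψ] using congrArg (fun T : V →L[𝕜] V => ψ (T v)) hX

end ConstantRank

section Strata

variable {ι : Type*} [Fintype ι]

/-- `(v, w)` is a kernel pair of `A` if `v` is in the kernel of the rows of `A` indexed by the
support of `w`, and `w` is in the kernel of the rows indexed by the support of `v`. For Hermitian
`A`, these are the right and left kernel vectors, without zero entries, of a submatrix of `A`. -/
def IsKernelPair (A : Matrix ι ι ℂ) (v w : ι → ℂ) : Prop :=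
  (∀ i, w i ≠ 0 → (A *ᵥ v) i = 0) ∧ ∀ j, v j ≠ 0 → (A *ᵥ w) j = 0

/-- The directions along which, to first order, the ranks of all submatrices of the Hermitian
matrix `A` with rows and columns in `S` are constant. -/
def stratumTangent (A : Matrix ι ι ℂ) (S : Set ι) : Submodule ℝ (Matrix ι ι ℂ) where
  carrier := {X | ∀ v w, v.support ⊆ S → w.support ⊆ S → IsKernelPair A v w →
    star w ⬝ᵥ X *ᵥ v = 0}
  zero_mem' := by simp
  add_mem' hX hY v w hv hw h := by
    rw [add_mulVec, dotProduct_add, hX v w hv hw h, hY v w hv hw h, add_zero]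
  smul_mem' c X hX v w hv hw h := by
    rw [smul_mulVec, dotProduct_smul, hX v w hv hw h, smul_zero]

theorem mem_stratumTangent {A X : Matrix ι ι ℂ} {S : Set ι} :
    X ∈ stratumTangent A S ↔ ∀ v w, v.support ⊆ S → w.support ⊆ S → IsKernelPair A v w →
      star w ⬝ᵥ X *ᵥ v = 0 := Iff.rfl

open scoped Classical in
/-- The orthogonal projection onto the vectors supported in `P`, used to cut out submatrices
without changing their shape. -/
noncomputable def coordProj (P : Set ι) : Matrix ι ι ℂ :=
  diagonal (P.indicator 1)

theorem coordProj_mulVec (P : Set ι) (v : ι → ℂ) : coordProj P *ᵥ v = P.indicator v := by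
  ext i
  by_cases hi : i ∈ P <;> simp [coordProj, mulVec_diagonal, hi]

theorem vecMul_coordProj (P : Set ι) (v : ι → ℂ) : v ᵥ* coordProj P = P.indicator v := by
  ext i
  by_cases hi : i ∈ P <;> simp [coordProj, vecMul_diagonal, hi]

theorem exists_hasStrictFDerivAt_vanishing_of_matrix_rank_eq (A : Matrix ι ι ℂ) :
    ∃ (φ : Matrix ι ι ℂ → ((ι → ℂ) →L[ℂ] (ι → ℂ)))
      (φ' : Matrix ι ι ℂ →L[ℂ] ((ι → ℂ) →L[ℂ] (ι → ℂ))),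
      HasStrictFDerivAt φ φ' A ∧ φ A = 0 ∧ (∀ᶠ M in 𝓝 A, M.rank = A.rank → φ M = 0) ∧
      ∀ X, φ' X = 0 → ∀ v w, A *ᵥ v = 0 → w ᵥ* A = 0 → w ⬝ᵥ X *ᵥ v = 0 := by
  classical
  let T : Matrix ι ι ℂ →L[ℂ] ((ι → ℂ) →L[ℂ] (ι → ℂ)) := LinearMap.toContinuousLinearMap
    (LinearMap.toContinuousLinearMap.toLinearMap ∘ₗ (toLin' : Matrix ι ι ℂ ≃ₗ[ℂ] _).toLinearMap)
  obtain ⟨φ, φ', hφ, h0, hev, hker⟩ := exists_hasStrictFDerivAt_vanishing_of_rank_eq (T A)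
  refine ⟨φ ∘ T, φ'.comp T, hφ.comp A T.hasStrictFDerivAt, h0,
    T.continuous.continuousAt.eventually hev, fun X hX v w hv hw => ?_⟩
  refine hker (T X) hX v (dotProductBilin ℂ ℂ w) hv fun y => ?_
  change w ⬝ᵥ A *ᵥ y = 0
  rw [dotProduct_mulVec, hw, zero_dotProduct]

theorem IsKernelPair.coordProj_mul_mulVec {A : Matrix ι ι ℂ} {v w : ι → ℂ}
    (h : IsKernelPair A v w) : (coordProj w.support * A * coordProj v.support) *ᵥ v = 0 := by
  rw [← mulVec_mulVec, coordProj_mulVec, Set.indicator_support, ← mulVec_mulVec, coordProj_mulVec]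
  refine Set.indicator_eq_zero.2 ?_
  exact Set.disjoint_left.2 fun i hA hw => hA (h.1 i hw)

theorem IsKernelPair.vecMul_coordProj_mul {A : Matrix ι ι ℂ} {v w : ι → ℂ}
    (h : IsKernelPair A v w) (hA : A.IsHermitian) :
    star w ᵥ* (coordProj w.support * A * coordProj v.support) = 0 := by
  have hw : (star w).support = w.support := by ext; simp
  have hAw : star w ᵥ* A = star (A *ᵥ w) := by rw [star_mulVec, hA.eq]
  rw [← vecMul_vecMul, ← vecMul_vecMul, vecMul_coordProj, vecMul_coordProj,
    ← hw, Set.indicator_support, hAw]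
  refine Set.indicator_eq_zero.2 ?_
  exact Set.disjoint_left.2 fun i hA hv => hA (by simp [h.2 i hv])

theorem dotProduct_coordProj_mul_mulVec (X : Matrix ι ι ℂ) (v w : ι → ℂ) :
    star w ⬝ᵥ (coordProj w.support * X * coordProj v.support) *ᵥ v = star w ⬝ᵥ X *ᵥ v := by
  have hw : (star w).support = w.support := by ext; simp
  rw [← mulVec_mulVec, coordProj_mulVec, Set.indicator_support, ← mulVec_mulVec,
    dotProduct_mulVec, vecMul_coordProj, ← hw, Set.indicator_support]

/-- The ranks of all submatrices of `A`; its fibres are the strata of a stratification of the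
space of matrices. -/
noncomputable def rankTable (A : Matrix ι ι ℂ) (p : Set ι × Set ι) : ℕ :=
  (coordProj p.1 * A * coordProj p.2).rank

theorem dimH_le_of_finrank_stratumTangent {E κ : Type*} [NormedAddCommGroup E] [NormedSpace ℝ E]
    [FiniteDimensional ℝ E] [Finite κ] (S : Set E) (Λ : κ → E →ₗ[ℝ] Matrix ι ι ℂ) (d : ℕ)
    (hherm : ∀ a, ∀ x ∈ S, (Λ a x).IsHermitian)
    (h : ∀ x ∈ S, finrank ℝ (⨅ a, (stratumTangent (Λ a x) Set.univ).comap (Λ a) :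
      Submodule ℝ E) ≤ d) :
    dimH S ≤ d := by
  have := Fintype.ofFinite (κ × Set ι × Set ι)
  let Γ (q : κ × Set ι × Set ι) : E →L[ℝ] Matrix ι ι ℂ := LinearMap.toContinuousLinearMap
    (LinearMap.mulLeftRight ℝ (coordProj q.2.1, coordProj q.2.2) ∘ₗ Λ q.1)
  refine dimH_le_of_stratification (F := κ × Set ι × Set ι → ((ι → ℂ) →L[ℂ] (ι → ℂ))) S
    (fun x a => rankTable (Λ a x)) d fun x hx => ?_
  choose φ φ' hφ h0 hev hker using
    fun q => exists_hasStrictFDerivAt_vanishing_of_matrix_rank_eq (Γ q x)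
  refine ⟨fun y q => φ q (Γ q y),
    ContinuousLinearMap.pi fun q => ((φ' q).restrictScalars ℝ).comp (Γ q), ?_, ?_, ?_⟩
  · exact hasStrictFDerivAt_pi.2 fun q =>
      ((hφ q).restrictScalars ℝ).comp x (Γ q).hasStrictFDerivAt
  · refine (Submodule.finrank_mono fun X hX => Submodule.mem_iInf _ |>.2 fun a => ?_).trans (h x hx)
    refine mem_stratumTangent.2 fun v w _ _ hvw => ?_
    rw [← dotProduct_coordProj_mul_mulVec]
    exact hker (a, w.support, v.support) _ (congrFun hX _) v _ hvw.coordProj_mul_mulVec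
      (hvw.vecMul_coordProj_mul (hherm a x hx))
  · filter_upwards [eventually_all.2 fun q => (Γ q).continuous.continuousAt.eventually (hev q)]
      with y hy _ hσ
    funext q
    rw [hy q (congrFun (congrFun hσ q.1) q.2), h0]

end Strata

section BandMatrices

variable {n k : ℕ}

theorem mem_bandHerm {A : Matrix (Fin n) (Fin n) ℂ} :
    A ∈ bandHerm n k ↔
      A.IsHermitian ∧ ∀ i j : Fin n, A i j ≠ 0 → ((j : ℤ) - (i : ℤ)).natAbs ≤ k := by
  rw [← bandwidth_le_iff]
  rfl

theorem apply_eq_zero_of_mem_bandHerm {A : Matrix (Fin n) (Fin n) ℂ} (hA : A ∈ bandHerm n k)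
    {i j : Fin n} (h : k < ((j : ℤ) - (i : ℤ)).natAbs) : A i j = 0 := by
  by_contra h0
  exact absurd ((mem_bandHerm.1 hA).2 i j h0) (not_le.2 h)

theorem diagonal_mem_bandHerm {d : Fin n → ℂ} (hd : star d = d) : diagonal d ∈ bandHerm n k := by
  refine mem_bandHerm.2 ⟨isHermitian_diagonal_iff.2 fun i => congrFun hd i, fun i j h => ?_⟩
  obtain rfl : i = j := by_contra fun hij => h (diagonal_apply_ne d hij)
  simp

theorem one_mem_bandHerm : (1 : Matrix (Fin n) (Fin n) ℂ) ∈ bandHerm n k := by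
  rw [← diagonal_one]
  exact diagonal_mem_bandHerm (star_one _)

theorem sub_smul_one_mem_bandHerm {A : Matrix (Fin n) (Fin n) ℂ} (hA : A ∈ bandHerm n k) (s : ℝ) :
    A - s • (1 : Matrix (Fin n) (Fin n) ℂ) ∈ bandHerm n k :=
  sub_mem hA ((bandHerm n k).smul_mem s one_mem_bandHerm)

/-- The Hermitian matrix with entries `z` at `(i, j)` and `star z` at `(j, i)`, and with the sum
of the two if `i = j`. -/
def hermSingle {ι : Type*} [DecidableEq ι] (i j : ι) : ℂ →ₗ[ℝ] Matrix ι ι ℂ where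
  toFun z := single i j z + single j i (star z)
  map_add' z z' := by simp only [star_add, single_add]; abel
  map_smul' c z := by simp only [star_smul, star_trivial, RingHom.id_apply, smul_add, smul_single]

theorem hermSingle_apply {ι : Type*} [DecidableEq ι] (i j : ι) (z : ℂ) :
    hermSingle i j z = single i j z + single j i (star z) := rfl

theorem star_dotProduct_hermSingle_mulVec {ι : Type*} [Fintype ι] [DecidableEq ι] (i j : ι) (z : ℂ)
    (v w : ι → ℂ) :
    star w ⬝ᵥ hermSingle i j z *ᵥ v = star (w i) * z * v j + star (w j) * star z * v i := by
  rw [hermSingle_apply, add_mulVec, dotProduct_add, single_mulVec, single_mulVec,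
    ← Pi.single, ← Pi.single]
  simp [mul_assoc]

theorem hermSingle_mem_bandHerm {i j : Fin n} (h : ((j : ℤ) - (i : ℤ)).natAbs ≤ k) (z : ℂ) :
    hermSingle i j z ∈ bandHerm n k := by
  refine mem_bandHerm.2 ⟨?_, fun a b hab => by_contra fun hlt => hab ?_⟩
  · rw [IsHermitian, hermSingle_apply, conjTranspose_add, conjTranspose_single,
      conjTranspose_single, star_star, add_comm]
  · have hij : ¬(i = a ∧ j = b) := by rintro ⟨rfl, rfl⟩; exact hlt h
    have hji : ¬(j = a ∧ i = b) := by rintro ⟨rfl, rfl⟩; omega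
    rw [hermSingle_apply, Matrix.add_apply, single_apply, single_apply, if_neg hij, if_neg hji,
      add_zero]

theorem star_dotProduct_mulVec_comm {ι : Type*} [Fintype ι] {A : Matrix ι ι ℂ} (hA : A.IsHermitian)
    (v w : ι → ℂ) : star v ⬝ᵥ A *ᵥ w = star (star w ⬝ᵥ A *ᵥ v) := by
  rw [← star_dotProduct_star, star_star, star_mulVec, hA.eq, ← dotProduct_mulVec]

end BandMatrices

section Compression

variable {n k : ℕ}

theorem finrank_add_le_of_le_of_mem {K V T : Type*} [Field K] [AddCommGroup V] [Module K V]
    [FiniteDimensional K V] [AddCommGroup T] [Module K T] {W W' : Submodule K V} (hW : W ≤ W')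
    (Ψ : T →ₗ[K] V) (hΨ : ∀ t, Ψ t ∈ W') (h : ∀ t, Ψ t ∈ W → t = 0) :
    finrank K W + finrank K T ≤ finrank K W' := by
  have hinj : Function.Injective Ψ :=
    (injective_iff_map_eq_zero _).2 fun t ht => h t (ht ▸ W.zero_mem)
  have hdisj : W ⊓ LinearMap.range Ψ = ⊥ := by
    refine (Submodule.eq_bot_iff _).2 ?_
    rintro _ ⟨hmem, t, rfl⟩
    rw [h t hmem, map_zero]
  have hsup : W ⊔ LinearMap.range Ψ ≤ W' := sup_le hW (by rintro _ ⟨t, rfl⟩; exact hΨ t)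
  have hadd := Submodule.finrank_sup_add_finrank_inf_eq W (LinearMap.range Ψ)
  rw [hdisj, finrank_bot, add_zero, LinearMap.finrank_range_of_inj hinj] at hadd
  exact hadd ▸ Submodule.finrank_mono hsup

theorem finrank_add_le_of_le_ker {K V T : Type*} [Field K] [AddCommGroup V] [Module K V]
    [FiniteDimensional K V] [AddCommGroup T] [Module K T] {W : Submodule K V} {Φ : V →ₗ[K] T}
    (h : W ≤ LinearMap.ker Φ) (hΦ : Function.Surjective Φ) :
    finrank K W + finrank K T ≤ finrank K V := by
  have := Φ.finrank_range_add_finrank_ker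
  rw [LinearMap.range_eq_top.2 hΦ, finrank_top] at this
  have := Submodule.finrank_mono h
  omega

theorem exists_eq_re_mul (f : ℂ →ₗ[ℝ] ℝ) : ∃ γ : ℂ, ∀ z, f z = (γ * z).re := by
  refine ⟨⟨f 1, -f Complex.I⟩, fun z => ?_⟩
  have hz : z = z.re • (1 : ℂ) + z.im • Complex.I := by apply Complex.ext <;> simp
  conv_lhs => rw [hz]
  rw [map_add, map_smul, map_smul]
  simp only [smul_eq_mul, Complex.mul_re]
  ring

/-- The compression of a Hermitian band matrix to the span of `v` and `w`: the diagonal entries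
and the upper off-diagonal entry of its Gram matrix with respect to `v` and `w`. -/
noncomputable def compression (k : ℕ) (v w : Fin n → ℂ) : bandHerm n k →ₗ[ℝ] ℝ × ℝ × ℂ where
  toFun X := ((star v ⬝ᵥ X.1 *ᵥ v).re, (star w ⬝ᵥ X.1 *ᵥ w).re, star v ⬝ᵥ X.1 *ᵥ w)
  map_add' X Y := by simp [add_mulVec, dotProduct_add]
  map_smul' c X := by simp [smul_mulVec, dotProduct_smul]

theorem compression_apply (v w : Fin n → ℂ) (X : bandHerm n k) :
    compression k v w X
      = ((star v ⬝ᵥ X.1 *ᵥ v).re, (star w ⬝ᵥ X.1 *ᵥ w).re, star v ⬝ᵥ X.1 *ᵥ w) := rfl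

theorem exists_form_eq_zero_of_not_surjective_compression {v w : Fin n → ℂ}
    (h : ¬Function.Surjective (compression k v w)) :
    ∃ (α β : ℝ) (γ : ℂ), ¬(α = 0 ∧ β = 0 ∧ γ = 0) ∧
      ∀ i j : Fin n, ((j : ℤ) - (i : ℤ)).natAbs ≤ k →
        α * (star (v i) * v j) + β * (star (w i) * w j) + γ * (star (v i) * w j)
          + star γ * (star (w i) * v j) = 0 := by
  rw [← LinearMap.range_eq_top] at h
  obtain ⟨f, hf, hker⟩ := Submodule.exists_le_ker_of_lt_top _ (lt_top_iff_ne_top.2 h)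
  obtain ⟨γ, hγ⟩ := exists_eq_re_mul (f ∘ₗ LinearMap.inr ℝ ℝ (ℝ × ℂ) ∘ₗ LinearMap.inr ℝ ℝ ℂ)
  have hf_apply (a b c) : f (a, b, c) = a * f (1, 0, 0) + b * f (0, 1, 0) + (γ * c).re := by
    have : ((a, b, c) : ℝ × ℝ × ℂ) = a • (1, 0, 0) + b • (0, 1, 0) + (0, 0, c) := by simp
    rw [this, map_add, map_add, map_smul, map_smul, ← hγ c]
    rfl
  refine ⟨2 * f (1, 0, 0), 2 * f (0, 1, 0), γ, fun ⟨hα, hβ, hγ0⟩ => hf ?_, fun i j hij => ?_⟩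
  · refine LinearMap.ext fun ⟨a, b, c⟩ => ?_
    rw [hf_apply, hγ0, (mul_eq_zero.1 hα).resolve_left two_ne_zero,
      (mul_eq_zero.1 hβ).resolve_left two_ne_zero]
    simp
  · have hre (q : ℂ) (hq : ∀ z, (q * z).re = 0) : q = 0 := by
      have h1 := hq (star q)
      rwa [Complex.star_def, Complex.mul_conj, Complex.ofReal_re, Complex.normSq_eq_zero] at h1
    refine hre _ fun z => ?_
    have hz : f (compression k v w ⟨_, hermSingle_mem_bandHerm hij z⟩) = 0 :=
      hker (LinearMap.mem_range_self _ _)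
    rw [compression_apply, hf_apply] at hz
    simp only [star_dotProduct_hermSingle_mulVec] at hz
    refine Eq.trans ?_ hz
    simp only [Complex.mul_re, Complex.add_re, Complex.mul_im, Complex.add_im, Complex.star_def,
      Complex.conj_re, Complex.conj_im, Complex.ofReal_re, Complex.ofReal_im, Complex.re_ofNat,
      Complex.im_ofNat, Complex.ofReal_mul, Complex.ofReal_ofNat]
    ring

theorem mul_ne_mul_star_of_form_eq_zero {ι : Type*} {v w : ι → ℂ}
    (hvw : LinearIndependent ℂ ![v, w]) {α β : ℝ} {γ : ℂ} (hne : ¬(α = 0 ∧ β = 0 ∧ γ = 0))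
    (h : ∀ i, α * (star (v i) * v i) + β * (star (w i) * w i) + γ * (star (v i) * w i)
      + star γ * (star (w i) * v i) = 0) :
    (α * β : ℂ) ≠ γ * star γ := by
  intro hdet
  have hα : (α : ℂ) • v + γ • w = 0 := by
    funext i
    refine CStarRing.mul_star_self_eq_zero_iff _ |>.1 ?_
    simp only [Pi.add_apply, Pi.smul_apply, smul_eq_mul, star_add, star_mul', Complex.star_def,
      Complex.conj_ofReal] at h hdet ⊢
    linear_combination α * h i - w i * (starRingEnd ℂ) (w i) * hdet
  have hβ : star γ • v + (β : ℂ) • w = 0 := by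
    funext i
    refine CStarRing.mul_star_self_eq_zero_iff _ |>.1 ?_
    simp only [Pi.add_apply, Pi.smul_apply, smul_eq_mul, star_add, star_mul', Complex.star_def,
      Complex.conj_ofReal, Complex.conj_conj] at h hdet ⊢
    linear_combination β * h i - v i * (starRingEnd ℂ) (v i) * hdet
  have hpair := LinearIndependent.pair_iff.1 hvw
  exact hne ⟨Complex.ofReal_eq_zero.1 (hpair _ _ hα).1, Complex.ofReal_eq_zero.1 (hpair _ _ hβ).2,
    (hpair _ _ hα).2⟩

theorem mul_eq_mul_of_not_surjective_compression {v w : Fin n → ℂ}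
    (hvw : LinearIndependent ℂ ![v, w]) (h : ¬Function.Surjective (compression k v w))
    {i j : Fin n} (hij : ((j : ℤ) - (i : ℤ)).natAbs ≤ k) : v i * w j = v j * w i := by
  obtain ⟨α, β, γ, hne, hform⟩ := exists_form_eq_zero_of_not_surjective_compression h
  have hdet : (α * β - γ * star γ : ℂ) ≠ 0 := sub_ne_zero.2 <|
    mul_ne_mul_star_of_form_eq_zero hvw hne fun i => hform i i (by simp)
  let r₁ := α * star (v i) + star γ * star (w i)
  let r₂ := γ * star (v i) + β * star (w i)
  have hi : r₁ * v i + r₂ * w i = 0 := by linear_combination hform i i (by simp)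
  have hj : r₁ * v j + r₂ * w j = 0 := by linear_combination hform i j hij
  have h₁ : r₁ * (v i * w j - v j * w i) = 0 := by linear_combination w j * hi - w i * hj
  have h₂ : r₂ * (v i * w j - v j * w i) = 0 := by linear_combination v i * hj - v j * hi
  by_contra hne'
  have hr₁ : r₁ = 0 := (mul_eq_zero.1 h₁).resolve_right (sub_ne_zero.2 hne')
  have hr₂ : r₂ = 0 := (mul_eq_zero.1 h₂).resolve_right (sub_ne_zero.2 hne')
  have hv : (α * β - γ * star γ) * star (v i) = 0 := by
    linear_combination β * hr₁ - star γ * hr₂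
  have hw : (α * β - γ * star γ) * star (w i) = 0 := by
    linear_combination α * hr₂ - γ * hr₁
  rw [mul_eq_zero, or_iff_right hdet, star_eq_zero] at hv hw
  exact hne' (by rw [hv, hw]; ring)

end Compression

section KernelOn

variable {ι : Type*} [Fintype ι] {A : Matrix ι ι ℂ} {S T : Set ι}

/-- The kernel of the principal submatrix of `A` on `S`, its vectors being extended by zero. -/
def kernelOn (A : Matrix ι ι ℂ) (S : Set ι) : Submodule ℂ (ι → ℂ) where
  carrier := {v | v.support ⊆ S ∧ ∀ i ∈ S, (A *ᵥ v) i = 0}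
  zero_mem' := by simp
  add_mem' := by
    rintro v w ⟨hv, hv'⟩ ⟨hw, hw'⟩
    refine ⟨(Function.support_add v w).trans (Set.union_subset hv hw), fun i hi => ?_⟩
    rw [mulVec_add, Pi.add_apply, hv' i hi, hw' i hi, add_zero]
  smul_mem' := by
    rintro c v ⟨hv, hv'⟩
    refine ⟨(Function.support_const_smul_subset c v).trans hv, fun i hi => ?_⟩
    rw [mulVec_smul, Pi.smul_apply, hv' i hi, smul_zero]

theorem mem_kernelOn {v : ι → ℂ} :
    v ∈ kernelOn A S ↔ v.support ⊆ S ∧ ∀ i ∈ S, (A *ᵥ v) i = 0 := Iff.rfl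

theorem mem_kernelOn_univ {v : ι → ℂ} : v ∈ kernelOn A Set.univ ↔ A *ᵥ v = 0 := by
  simp [mem_kernelOn, funext_iff]

theorem mem_kernelOn_of_support_subset {v : ι → ℂ} (hv : v ∈ kernelOn A S) (hTS : T ⊆ S)
    (hvT : v.support ⊆ T) : v ∈ kernelOn A T :=
  ⟨hvT, fun i hi => hv.2 i (hTS hi)⟩

theorem isKernelPair_of_mem_kernelOn {v w : ι → ℂ} (hv : v ∈ kernelOn A S)
    (hw : w ∈ kernelOn A S) : IsKernelPair A v w :=
  ⟨fun i hi => hv.2 i (hw.1 hi), fun i hi => hw.2 i (hv.1 hi)⟩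

theorem apply_eq_zero_of_support_subset {α : Type*} {x : α → ℂ} {S : Set α} (hx : x.support ⊆ S)
    {i : α} (hi : i ∉ S) : x i = 0 :=
  Function.notMem_support.1 fun h => hi (hx h)

theorem exists_mulVec_eq_of_isHermitian {T : Matrix ι ι ℂ} (hT : T.IsHermitian) {b : ι → ℂ}
    (h : ∀ z, T *ᵥ z = 0 → star z ⬝ᵥ b = 0) : ∃ y, T *ᵥ y = b := by
  by_contra! hb
  obtain ⟨f, hfb, hf⟩ := Submodule.exists_le_ker_of_notMem
    (show b ∉ LinearMap.range T.mulVecLin from fun ⟨y, hy⟩ => hb y hy)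
  classical
  obtain ⟨c, rfl⟩ := (dotProductEquiv ℂ ι).surjective f
  have hc : c ᵥ* T = 0 := dotProduct_eq_zero_iff.1 fun y => by
    rw [← dotProduct_mulVec]
    exact hf (LinearMap.mem_range_self T.mulVecLin y)
  refine hfb ?_
  rw [dotProductEquiv_apply_apply, ← star_star c]
  refine h _ ?_
  rw [← hT.eq, ← star_vecMul, hc, star_zero]

theorem isHermitian_coordProj {α : Type*} (P : Set α) : (coordProj P).IsHermitian := by
  classical
  rw [coordProj, isHermitian_diagonal_iff]
  intro i
  by_cases hi : i ∈ P <;> simp [hi, IsSelfAdjoint]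

theorem star_vecMul_coordProj (P : Set ι) (z : ι → ℂ) :
    star z ᵥ* coordProj P = star (P.indicator z) := by
  rw [← coordProj_mulVec, star_mulVec, (isHermitian_coordProj P).eq]

theorem exists_solution_of_kernelOn (hA : A.IsHermitian) {g : ι} (hg : g ∉ S)
    (h : ∀ z ∈ kernelOn A S, (A *ᵥ z) g = 0) :
    ∃ w : ι → ℂ, w g = 1 ∧ w.support ⊆ insert g S ∧ ∀ i ∈ S, (A *ᵥ w) i = 0 := by
  classical
  let P := coordProj S
  have hP : P.IsHermitian := isHermitian_coordProj S
  have hPAP (z : ι → ℂ) : (P * A * P) *ᵥ z = S.indicator (A *ᵥ S.indicator z) := by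
    rw [← mulVec_mulVec, ← mulVec_mulVec, coordProj_mulVec, coordProj_mulVec]
  have hT : (P * A * P).IsHermitian := by
    rw [IsHermitian, conjTranspose_mul, conjTranspose_mul, hA.eq, hP.eq, mul_assoc]
  obtain ⟨y, hy⟩ := exists_mulVec_eq_of_isHermitian hT
    (b := -S.indicator (A *ᵥ Pi.single g 1)) fun z hz => by
      have hzS : S.indicator z ∈ kernelOn A S :=
        ⟨Set.support_indicator_subset, fun i hi => by
          simpa [hPAP, hi] using congrFun hz i⟩
      rw [dotProduct_neg, neg_eq_zero, ← coordProj_mulVec, dotProduct_mulVec,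
        star_vecMul_coordProj, star_dotProduct_mulVec_comm hA]
      simp [h _ hzS]
  refine ⟨S.indicator y + Pi.single g 1, by simp [hg], fun i hi => ?_, fun i hi => ?_⟩
  · by_contra! hi'
    rw [Set.mem_insert_iff, not_or] at hi'
    exact hi (by simp [hi'.1, hi'.2])
  · have hyi := congrFun hy i
    rw [hPAP, Pi.neg_apply, Set.indicator_of_mem hi, Set.indicator_of_mem hi] at hyi
    rw [mulVec_add, Pi.add_apply, hyi, neg_add_cancel]

theorem exists_isKernelPair_extension (hA : A.IsHermitian) {u : ι → ℂ} {g : ι}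
    (hu : u ∈ kernelOn A S) (hspan : ∀ z ∈ kernelOn A S, ∃ c : ℂ, z = c • u)
    (hg : g ∉ S) (hAu : (A *ᵥ u) g = 0) :
    ∃ w : ι → ℂ, w g = 1 ∧ w.support ⊆ insert g S ∧ IsKernelPair A u w := by
  obtain ⟨w, hwg, hwS, hAw⟩ := exists_solution_of_kernelOn hA hg fun z hz => by
    obtain ⟨c, rfl⟩ := hspan z hz
    rw [mulVec_smul, Pi.smul_apply, hAu, smul_zero]
  refine ⟨w, hwg, hwS, fun i hi => ?_, fun i hi => hAw i (hu.1 hi)⟩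
  obtain rfl | hiS := hwS hi
  · exact hAu
  · exact hu.2 i hiS

theorem exists_linearIndependent_pair_or_forall_eq_smul {K V : Type*} [Field K] [AddCommGroup V]
    [Module K V] (W : Submodule K V) :
    (∃ v ∈ W, ∃ w ∈ W, LinearIndependent K ![v, w]) ∨
      ∀ u ∈ W, u ≠ 0 → ∀ z ∈ W, ∃ c : K, z = c • u := by
  refine or_iff_not_imp_left.2 fun h u hu hu0 z hz => ?_
  by_contra! hc
  exact h ⟨u, hu, z, hz, (LinearIndependent.pair_iff' hu0).2 fun a ha => hc a ha.symm⟩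

end KernelOn

section BandTangent

variable {n k : ℕ} {A : Matrix (Fin n) (Fin n) ℂ} {S T : Set (Fin n)}

/-- The directions in `bandHerm n k` along which, to first order, the ranks of the submatrices
of `A` with rows and columns in `S` are constant. -/
noncomputable def bandTangent (k : ℕ) (A : Matrix (Fin n) (Fin n) ℂ) (S : Set (Fin n)) :
    Submodule ℝ (bandHerm n k) :=
  (stratumTangent A S).comap (bandHerm n k).subtype

theorem mem_bandTangent {X : bandHerm n k} :
    X ∈ bandTangent k A S ↔ ∀ v w, v.support ⊆ S → w.support ⊆ S → IsKernelPair A v w →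
      star w ⬝ᵥ X.1 *ᵥ v = 0 := Iff.rfl

theorem bandTangent_anti (h : S ⊆ T) : bandTangent k A T ≤ bandTangent k A S :=
  fun _ hX v w hv hw hvw => hX v w (hv.trans h) (hw.trans h) hvw

theorem hermSingle_mem_bandTangent {i j : Fin n} (hij : ((j : ℤ) - (i : ℤ)).natAbs ≤ k)
    (hj : j ∉ S) (z : ℂ) :
    (⟨hermSingle i j z, hermSingle_mem_bandHerm hij z⟩ : bandHerm n k) ∈ bandTangent k A S := by
  refine mem_bandTangent.2 fun v w hv hw _ => ?_
  rw [star_dotProduct_hermSingle_mulVec, apply_eq_zero_of_support_subset hv hj,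
    apply_eq_zero_of_support_subset hw hj]
  simp

theorem re_eq_zero_of_star_dotProduct_hermSingle_self {ι : Type*} [Fintype ι] [DecidableEq ι]
    {i : ι} {z : ℂ} {x : ι → ℂ} (hx : x i ≠ 0) (h : star x ⬝ᵥ hermSingle i i z *ᵥ x = 0) :
    z.re = 0 := by
  rw [star_dotProduct_hermSingle_mulVec] at h
  have h2 : ((2 * z.re : ℝ) : ℂ) * (star (x i) * x i) = 0 := by
    rw [← Complex.add_conj, ← h, Complex.star_def]
    ring
  simpa [hx] using h2

theorem finrank_bandTangent_add_one_le (h : S ⊆ T) {x : Fin n → ℂ} (hx : x.support ⊆ T)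
    (hxx : IsKernelPair A x x) {l : Fin n} (hl : l ∉ S) (hxl : x l ≠ 0) :
    finrank ℝ (bandTangent k A T) + 1 ≤ finrank ℝ (bandTangent k A S) := by
  refine Submodule.finrank_lt_finrank_of_lt (lt_of_le_of_ne (bandTangent_anti h) fun heq => ?_)
  have hX := hermSingle_mem_bandTangent (k := k) (A := A) (i := l) (by simp) hl 1
  rw [← heq] at hX
  exact one_ne_zero (re_eq_zero_of_star_dotProduct_hermSingle_self hxl (hX x x hx hx hxx))

theorem finrank_bandTangent_add_three_le (h : S ⊆ T) {u w : Fin n → ℂ} {g j : Fin n}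
    (hu : u.support ⊆ T) (hw : w.support ⊆ T) (huu : IsKernelPair A u u)
    (huw : IsKernelPair A u w) (hgj : ((j : ℤ) - (g : ℤ)).natAbs ≤ k) (hj : j ∉ S)
    (huj : u j ≠ 0) (hug : u g = 0) (hwg : w g ≠ 0) :
    finrank ℝ (bandTangent k A T) + 3 ≤ finrank ℝ (bandTangent k A S) := by
  have hjj : ((j : ℤ) - (j : ℤ)).natAbs ≤ k := by simp
  let probe (i : Fin n) (hi : ((j : ℤ) - (i : ℤ)).natAbs ≤ k) : ℂ →ₗ[ℝ] bandHerm n k :=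
    (hermSingle i j).codRestrict (bandHerm n k) (hermSingle_mem_bandHerm hi)
  let Ψ : ℝ × ℂ →ₗ[ℝ] bandHerm n k :=
    (probe j hjj ∘ₗ Complex.ofRealCLM.toLinearMap).coprod (probe g hgj)
  have hΨ (a : ℝ) (z : ℂ) (p q : Fin n → ℂ) : star q ⬝ᵥ (Ψ (a, z)).1 *ᵥ p =
      star q ⬝ᵥ hermSingle j j (a : ℂ) *ᵥ p + star q ⬝ᵥ hermSingle g j z *ᵥ p := by
    rw [← dotProduct_add, ← add_mulVec]
    rfl
  have hdim : finrank ℝ (ℝ × ℂ) = 3 := by simp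
  rw [← hdim]
  refine finrank_add_le_of_le_of_mem (bandTangent_anti h) Ψ (fun t => add_mem
    (hermSingle_mem_bandTangent hjj hj _) (hermSingle_mem_bandTangent hgj hj _)) ?_
  rintro ⟨a, z⟩ hmem
  have ha := hmem u u hu hu huu
  have hz := hmem u w hu hw huw
  rw [Submodule.subtype_apply, hΨ] at ha hz
  obtain rfl : a = 0 := re_eq_zero_of_star_dotProduct_hermSingle_self (z := (a : ℂ)) huj <| by
    rw [← ha, star_dotProduct_hermSingle_mulVec g j z, hug]
    simp
  rw [Complex.ofReal_zero, map_zero, zero_mulVec, dotProduct_zero, zero_add,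
    star_dotProduct_hermSingle_mulVec, hug, mul_zero, add_zero] at hz
  obtain rfl : z = 0 := by simpa [hwg, huj] using hz
  rfl

theorem bandTangent_le_ker_compression {v w : Fin n → ℂ} (hv : v ∈ kernelOn A S)
    (hw : w ∈ kernelOn A S) : bandTangent k A S ≤ LinearMap.ker (compression k v w) := by
  intro X hX
  rw [LinearMap.mem_ker, compression_apply,
    mem_bandTangent.1 hX v v hv.1 hv.1 (isKernelPair_of_mem_kernelOn hv hv),
    mem_bandTangent.1 hX w w hw.1 hw.1 (isKernelPair_of_mem_kernelOn hw hw),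
    mem_bandTangent.1 hX w v hw.1 hv.1 (isKernelPair_of_mem_kernelOn hw hv)]
  rfl

theorem finrank_bandTangent_add_four_le_of_surjective {v w : Fin n → ℂ} (hv : v ∈ kernelOn A S)
    (hw : w ∈ kernelOn A S) (h : Function.Surjective (compression k v w)) :
    finrank ℝ (bandTangent k A S) + 4 ≤ finrank ℝ (bandHerm n k) := by
  have hdim : finrank ℝ (ℝ × ℝ × ℂ) = 4 := by simp
  rw [← hdim]
  exact finrank_add_le_of_le_ker (bandTangent_le_ker_compression hv hw) h

theorem star_dotProduct_mulVec_eq_zero_of_mem_bandTangent {X : bandHerm n k}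
    (hX : X ∈ bandTangent k A Set.univ) {v w : Fin n → ℂ} (hv : A *ᵥ v = 0) (hw : A *ᵥ w = 0) :
    star w ⬝ᵥ X.1 *ᵥ v = 0 :=
  hX v w (Set.subset_univ _) (Set.subset_univ _)
    (isKernelPair_of_mem_kernelOn (mem_kernelOn_univ.2 hv) (mem_kernelOn_univ.2 hw))

end BandTangent

section Codimension

variable {n k : ℕ} {A : Matrix (Fin n) (Fin n) ℂ} {S : Set (Fin n)}

theorem mul_eq_mul_of_mul_eq_mul {K : Type*} [Field K] {a b c d e f : K} (hcd : c ≠ 0 ∨ d ≠ 0)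
    (hac : b * c = a * d) (hce : c * f = e * d) : b * e = a * f := by
  obtain hc | hd := hcd
  · refine mul_left_cancel₀ hc ?_
    linear_combination e * hac - a * hce
  · refine mul_left_cancel₀ hd ?_
    linear_combination f * hac - b * hce

theorem exists_first_mul_ne_mul {ι K : Type*} [LinearOrder ι] [WellFoundedLT ι] [Field K]
    {v w : ι → K} (hvw : LinearIndependent K ![v, w]) :
    ∃ s j, s < j ∧ (v s ≠ 0 ∨ w s ≠ 0) ∧ w s * v j ≠ v s * w j ∧
      ∀ i < j, w s * v i = v s * w i := by
  obtain ⟨s, hs⟩ := exists_minimal_of_wellFoundedLT (fun i => v i ≠ 0 ∨ w i ≠ 0) <| by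
    obtain ⟨i, hi⟩ := Function.ne_iff.1 (hvw.ne_zero 0)
    exact ⟨i, Or.inl hi⟩
  obtain ⟨j, hj⟩ := exists_minimal_of_wellFoundedLT (fun i => w s * v i ≠ v s * w i) <| by
    by_contra! h
    have hpair := LinearIndependent.pair_iff.1 hvw (w s) (-v s) <| by
      funext i
      simp [h i]
    exact hs.prop.elim (· (neg_eq_zero.1 hpair.2)) (· hpair.1)
  refine ⟨s, j, ?_, hs.prop, hj.prop, fun i hi => not_not.1 (hj.not_prop_of_lt hi)⟩
  refine lt_of_le_of_ne (not_lt.1 fun hjs => hj.prop ?_) fun hsj => hj.prop ?_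
  · have := hs.not_prop_of_lt hjs
    simp_all
  · rw [hsj, mul_comm]

theorem exists_gap {v w : Fin n → ℂ} (hvw : LinearIndependent ℂ ![v, w])
    (h : ∀ i j : Fin n, ((j : ℤ) - (i : ℤ)).natAbs ≤ k → v i * w j = v j * w i) :
    ∃ (l j : Fin n) (x u : Fin n → ℂ),
      x ∈ Submodule.span ℂ {v, w} ∧ u ∈ Submodule.span ℂ {v, w} ∧ (l : ℕ) + k < j ∧
      x l ≠ 0 ∧ (∀ i, l < i → i < j → x i = 0) ∧ u j ≠ 0 ∧ ∀ i < j, u i = 0 := by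
  obtain ⟨s, j, hsj, hs, hj, hmin⟩ := exists_first_mul_ne_mul hvw
  obtain ⟨l, hl⟩ := exists_maximal_of_wellFoundedGT (fun i => (v i ≠ 0 ∨ w i ≠ 0) ∧ i < j)
    ⟨s, hs, hsj⟩
  have hgap (i) (hli : l < i) (hij : i < j) : v i = 0 ∧ w i = 0 := by
    have := hl.not_prop_of_gt hli
    simp_all
  have hlj : (l : ℕ) + k < j := by
    have hlj : (l : ℕ) < j := hl.prop.2
    by_contra hle
    exact hj (mul_eq_mul_of_mul_eq_mul hl.prop.1 (hmin l hlj) (h l j (by omega)))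
  have hv : v ∈ Submodule.span ℂ {v, w} := Submodule.subset_span (by simp)
  have hw : w ∈ Submodule.span ℂ {v, w} := Submodule.subset_span (by simp)
  have hu : w s • v - v s • w ∈ Submodule.span ℂ {v, w} :=
    sub_mem (Submodule.smul_mem _ _ hv) (Submodule.smul_mem _ _ hw)
  have huj : (w s • v - v s • w) j ≠ 0 := sub_ne_zero.2 hj
  have hu0 (i) (hi : i < j) : (w s • v - v s • w) i = 0 := sub_eq_zero.2 (hmin i hi)
  obtain hvl | hwl := hl.prop.1
  · exact ⟨l, j, v, _, hv, hu, hlj, hvl, fun i hli hij => (hgap i hli hij).1, huj, hu0⟩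
  · exact ⟨l, j, w, _, hw, hu, hlj, hwl, fun i hli hij => (hgap i hli hij).2, huj, hu0⟩

theorem mulVec_apply_eq_zero_of_mem_bandHerm (hA : A ∈ bandHerm n k) {x : Fin n → ℂ} {i : Fin n}
    (h : ∀ j ∈ x.support, k < ((j : ℤ) - (i : ℤ)).natAbs) : (A *ᵥ x) i = 0 := by
  rw [mulVec, dotProduct]
  refine Finset.sum_eq_zero fun j _ => ?_
  by_cases hj : x j = 0
  · rw [hj, mul_zero]
  · rw [apply_eq_zero_of_mem_bandHerm hA (h j hj), zero_mul]

theorem indicator_mem_kernelOn_of_gap (hA : A ∈ bandHerm n k) {x : Fin n → ℂ}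
    (hx : x ∈ kernelOn A S) {l j : Fin n} (hlj : (l : ℕ) + k < j)
    (hgap : ∀ i, l < i → i < j → x i = 0) :
    (Set.Iic l).indicator x + (Set.Ici j).indicator x = x ∧
      (Set.Iic l).indicator x ∈ kernelOn A (S ∩ Set.Iic l) ∧
      (Set.Ici j).indicator x ∈ kernelOn A (S ∩ Set.Ici j) := by
  have hlj' : l < j := by rw [Fin.lt_def]; omega
  have hsum : (Set.Iic l).indicator x + (Set.Ici j).indicator x = x := by
    funext i
    obtain hil | hli := le_or_gt i l
    · simp [hil, hil.trans_lt hlj']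
    · obtain hij | hji := lt_or_ge i j
      · simp [hli, hij, hgap i hli hij]
      · simp [hli, hji]
  have hA_add (i) : (A *ᵥ (Set.Iic l).indicator x) i + (A *ᵥ (Set.Ici j).indicator x) i =
      (A *ᵥ x) i := by
    rw [← Pi.add_apply, ← mulVec_add, hsum]
  have hL (i) (hi : j ≤ i) : (A *ᵥ (Set.Iic l).indicator x) i = 0 :=
    mulVec_apply_eq_zero_of_mem_bandHerm hA fun i' hi' => by
      have : i' ∈ Set.Iic l := Set.support_indicator_subset hi'
      rw [Set.mem_Iic, Fin.le_def] at this
      rw [Fin.le_def] at hi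
      omega
  have hR (i) (hi : i ≤ l) : (A *ᵥ (Set.Ici j).indicator x) i = 0 :=
    mulVec_apply_eq_zero_of_mem_bandHerm hA fun i' hi' => by
      have : i' ∈ Set.Ici j := Set.support_indicator_subset hi'
      rw [Set.mem_Ici, Fin.le_def] at this
      rw [Fin.le_def] at hi
      omega
  refine ⟨hsum, ⟨?_, fun i ⟨hiS, hil⟩ => ?_⟩, ⟨?_, fun i ⟨hiS, hji⟩ => ?_⟩⟩
  · rw [Set.support_indicator]
    exact fun i hi => ⟨hx.1 hi.2, hi.1⟩
  · rw [← hx.2 i hiS, ← hA_add, hR i hil, add_zero]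
  · rw [Set.support_indicator]
    exact fun i hi => ⟨hx.1 hi.2, hi.1⟩
  · rw [← hx.2 i hiS, ← hA_add, hL i hji, zero_add]

theorem finrank_bandTangent_add_three_le_of_mem_kernelOn (hA : A.IsHermitian) {R T : Set (Fin n)}
    (hTS : T ⊆ S) (hRS : R ⊆ S) {u : Fin n → ℂ} (hu : u ∈ kernelOn A R)
    (hspan : ∀ z ∈ kernelOn A R, ∃ c : ℂ, z = c • u) {g j : Fin n} (hgS : g ∈ S) (hgR : g ∉ R)
    (hAu : (A *ᵥ u) g = 0) (hgj : ((j : ℤ) - (g : ℤ)).natAbs ≤ k) (hj : j ∉ T) (huj : u j ≠ 0) :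
    finrank ℝ (bandTangent k A S) + 3 ≤ finrank ℝ (bandTangent k A T) := by
  obtain ⟨w, hwg, hwR, huw⟩ := exists_isKernelPair_extension hA hu hspan hgR hAu
  exact finrank_bandTangent_add_three_le hTS (hu.1.trans hRS)
    (hwR.trans (Set.insert_subset hgS hRS)) (isKernelPair_of_mem_kernelOn hu hu) huw hgj hj huj
    (apply_eq_zero_of_support_subset hu.1 hgR) (hwg ▸ one_ne_zero)

theorem finrank_bandTangent_add_six_le_of_gap (hk : 0 < k) (hA : A.IsHermitian)
    (hS : S.OrdConnected) {l j : Fin n} (hl : l ∈ S) (hj : j ∈ S) (hlj : (l : ℕ) + k < j)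
    {u x y : Fin n → ℂ} (hu : u ∈ kernelOn A S) (hxy : x + y ∈ kernelOn A S)
    (huR : u ∈ kernelOn A (S ∩ Set.Ici j)) (hy : y ∈ kernelOn A (S ∩ Set.Ici j))
    (hx : x ∈ kernelOn A (S ∩ Set.Iic l)) (huj : u j ≠ 0) (hxl : x l ≠ 0)
    (hspanR : ∀ z ∈ kernelOn A (S ∩ Set.Ici j), ∃ c : ℂ, z = c • u)
    (hspanL : ∀ z ∈ kernelOn A (S ∩ Set.Iic l), ∃ c : ℂ, z = c • x) :
    finrank ℝ (bandTangent k A S) + 6 ≤ finrank ℝ (bandHerm n k) := by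
  let g : Fin n := ⟨j - 1, by omega⟩
  let g' : Fin n := ⟨l + 1, by omega⟩
  have hgS : g ∈ S := hS.out hl hj ⟨Fin.le_def.2 (by simp [g]; omega), Fin.le_def.2 (by simp [g])⟩
  have hgS' : g' ∈ S :=
    hS.out hl hj ⟨Fin.le_def.2 (by simp [g']), Fin.le_def.2 (by simp [g']; omega)⟩
  have hAx : (A *ᵥ x) g' = 0 := by
    obtain ⟨c, rfl⟩ := hspanR y hy
    simpa [mulVec_add, mulVec_smul, hu.2 g' hgS'] using hxy.2 g' hgS'
  have hjL : j ∉ insert g' (S ∩ Set.Iic l) := by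
    rintro (h | ⟨-, h⟩)
    · have := Fin.val_eq_of_eq h
      simp [g'] at this
      omega
    · have := Fin.le_def.1 h
      omega
  have hright := finrank_bandTangent_add_three_le_of_mem_kernelOn (k := k) hA
    (Set.insert_subset hgS' Set.inter_subset_left) Set.inter_subset_left huR hspanR hgS
    (fun h => by have := Fin.le_def.1 h.2; simp [g] at this; omega) (hu.2 g hgS)
    (by simp [g]; omega) hjL huj
  have hleft := finrank_bandTangent_add_three_le_of_mem_kernelOn (k := k) hA (Set.empty_subset _)
    (Set.subset_insert g' _) hx hspanL (Set.mem_insert _ _)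
    (fun h => by have := Fin.le_def.1 h.2; simp [g'] at this) hAx
    (by simp [g']; omega) (Set.notMem_empty l) hxl
  have := (bandTangent k A ∅).finrank_le
  omega

theorem finrank_bandTangent_add_five_le_of_gap (hk : 0 < k) (hA : A ∈ bandHerm n k)
    (hS : S.OrdConnected)
    (ih : ∀ T ⊂ S, T.OrdConnected → ∀ v ∈ kernelOn A T, ∀ w ∈ kernelOn A T,
      LinearIndependent ℂ ![v, w] →
        finrank ℝ (bandTangent k A T) + 4 ≤ finrank ℝ (bandHerm n k))
    {l j : Fin n} (hlj : (l : ℕ) + k < j) {x u : Fin n → ℂ} (hx : x ∈ kernelOn A S)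
    (hu : u ∈ kernelOn A S) (hxl : x l ≠ 0) (hgap : ∀ i, l < i → i < j → x i = 0)
    (huj : u j ≠ 0) (hu0 : ∀ i < j, u i = 0) :
    finrank ℝ (bandTangent k A S) + 5 ≤ finrank ℝ (bandHerm n k) := by
  have hlj' : l < j := by rw [Fin.lt_def]; omega
  have hlS : l ∈ S := hx.1 hxl
  have hjS : j ∈ S := hu.1 huj
  have huR : u ∈ kernelOn A (S ∩ Set.Ici j) :=
    mem_kernelOn_of_support_subset hu Set.inter_subset_left fun i hi =>
      ⟨hu.1 hi, not_lt.1 fun hij => hi (hu0 i hij)⟩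
  obtain ⟨hsum, hxL, hxR⟩ := indicator_mem_kernelOn_of_gap hA hx hlj hgap
  have hxl' : (Set.Iic l).indicator x l ≠ 0 := by simpa using hxl
  have hlR : l ∉ S ∩ Set.Ici j := fun h => hlj'.not_ge h.2
  have hjL : j ∉ S ∩ Set.Iic l := fun h => hlj'.not_ge h.2
  have hR := exists_linearIndependent_pair_or_forall_eq_smul (kernelOn A (S ∩ Set.Ici j))
  have hL := exists_linearIndependent_pair_or_forall_eq_smul (kernelOn A (S ∩ Set.Iic l))
  obtain ⟨v, hv, w, hw, hvw⟩ | hR := hR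
  · have h4 := ih _ ⟨Set.inter_subset_left, fun h => hlR (h hlS)⟩ (hS.inter Set.ordConnected_Ici)
      v hv w hw hvw
    have h1 := finrank_bandTangent_add_one_le (k := k) Set.inter_subset_left
      (hxL.1.trans Set.inter_subset_left) (isKernelPair_of_mem_kernelOn hxL hxL) hlR hxl'
    omega
  obtain ⟨v, hv, w, hw, hvw⟩ | hL := hL
  · have h4 := ih _ ⟨Set.inter_subset_left, fun h => hjL (h hjS)⟩ (hS.inter Set.ordConnected_Iic)
      v hv w hw hvw
    have h1 := finrank_bandTangent_add_one_le (k := k) Set.inter_subset_left hu.1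
      (isKernelPair_of_mem_kernelOn hu hu) hjL huj
    omega
  have h6 := finrank_bandTangent_add_six_le_of_gap hk (mem_bandHerm.1 hA).1 hS hlS hjS hlj hu
    (hsum.symm ▸ hx) huR hxR hxL huj hxl' (hR u huR fun h => huj (congrFun h j))
    (hL _ hxL fun h => hxl' (congrFun h l))
  omega

theorem finrank_bandTangent_add_four_le (hk : 0 < k) (hA : A ∈ bandHerm n k)
    (hS : S.OrdConnected) {v w : Fin n → ℂ} (hv : v ∈ kernelOn A S) (hw : w ∈ kernelOn A S)
    (hvw : LinearIndependent ℂ ![v, w]) :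
    finrank ℝ (bandTangent k A S) + 4 ≤ finrank ℝ (bandHerm n k) ∧
      (¬Function.Surjective (compression k v w) →
        finrank ℝ (bandTangent k A S) + 5 ≤ finrank ℝ (bandHerm n k)) := by
  induction S using WellFoundedLT.induction generalizing v w with
  | ind S ih =>
  have h5 (hns : ¬Function.Surjective (compression k v w)) :
      finrank ℝ (bandTangent k A S) + 5 ≤ finrank ℝ (bandHerm n k) := by
    obtain ⟨l, j, x, u, hx, hu, hlj, hxl, hgap, huj, hu0⟩ := exists_gap hvw
      fun i j hij => mul_eq_mul_of_not_surjective_compression hvw hns hij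
    have hspan : Submodule.span ℂ {v, w} ≤ kernelOn A S :=
      Submodule.span_le.2 (Set.insert_subset hv (Set.singleton_subset_iff.2 hw))
    exact finrank_bandTangent_add_five_le_of_gap hk hA hS
      (fun T hTS hT v' hv' w' hw' hvw' => (ih T hTS hT hv' hw' hvw').1) hlj (hspan hx) (hspan hu)
      hxl hgap huj hu0
  refine ⟨?_, h5⟩
  by_cases hs : Function.Surjective (compression k v w)
  · exact finrank_bandTangent_add_four_le_of_surjective hv hw hs
  · have := h5 hs
    omega

theorem finrank_bandTangent_add_five_le_of_not_surjective (hk : 0 < k) (hA : A ∈ bandHerm n k)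
    {v w : Fin n → ℂ} (hv : A *ᵥ v = 0) (hw : A *ᵥ w = 0) (hvw : LinearIndependent ℂ ![v, w])
    (hns : ¬Function.Surjective (compression k v w)) :
    finrank ℝ (bandTangent k A Set.univ) + 5 ≤ finrank ℝ (bandHerm n k) :=
  (finrank_bandTangent_add_four_le hk hA Set.ordConnected_univ (mem_kernelOn_univ.2 hv)
    (mem_kernelOn_univ.2 hw) hvw).2 hns

end Codimension

section Corank

variable {n k : ℕ} {A : Matrix (Fin n) (Fin n) ℂ}

/-- The first row of the compression of a Hermitian band matrix to the span of `u`, `v` and `w`.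
It measures the five extra real conditions that a third kernel vector imposes. -/
noncomputable def rowCompression (k : ℕ) (u v w : Fin n → ℂ) : bandHerm n k →ₗ[ℝ] ℝ × ℂ × ℂ where
  toFun X := ((star u ⬝ᵥ X.1 *ᵥ u).re, star u ⬝ᵥ X.1 *ᵥ v, star u ⬝ᵥ X.1 *ᵥ w)
  map_add' X Y := by simp [add_mulVec, dotProduct_add]
  map_smul' c X := by simp [smul_mulVec, dotProduct_smul]

theorem rowCompression_apply (u v w : Fin n → ℂ) (X : bandHerm n k) :
    rowCompression k u v w X
      = ((star u ⬝ᵥ X.1 *ᵥ u).re, star u ⬝ᵥ X.1 *ᵥ v, star u ⬝ᵥ X.1 *ᵥ w) := rfl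

open scoped ComplexOrder in
theorem exists_re_eq_zero_of_not_surjective_rowCompression {u v w : Fin n → ℂ} (hu : u ≠ 0)
    (h : ¬Function.Surjective (rowCompression k u v w)) :
    ∃ (α : ℝ) (β γ : ℂ), ¬(β = 0 ∧ γ = 0) ∧
      ∀ X : bandHerm n k, (star u ⬝ᵥ X.1 *ᵥ ((α : ℂ) • u + β • v + γ • w)).re = 0 := by
  rw [← LinearMap.range_eq_top] at h
  obtain ⟨f, hf, hker⟩ := Submodule.exists_le_ker_of_lt_top _ (lt_top_iff_ne_top.2 h)
  obtain ⟨β, hβ⟩ := exists_eq_re_mul (f ∘ₗ LinearMap.inr ℝ ℝ (ℂ × ℂ) ∘ₗ LinearMap.inl ℝ ℂ ℂ)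
  obtain ⟨γ, hγ⟩ := exists_eq_re_mul (f ∘ₗ LinearMap.inr ℝ ℝ (ℂ × ℂ) ∘ₗ LinearMap.inr ℝ ℂ ℂ)
  have hf_apply (a b c) : f (a, b, c) = a * f (1, 0, 0) + (β * b).re + (γ * c).re := by
    have : ((a, b, c) : ℝ × ℂ × ℂ) = a • (1, 0, 0) + (0, b, 0) + (0, 0, c) := by simp
    rw [this, map_add, map_add, map_smul, ← hβ b, ← hγ c]
    rfl
  have hzero (X : bandHerm n k) :
      (star u ⬝ᵥ X.1 *ᵥ ((f (1, 0, 0) : ℂ) • u + β • v + γ • w)).re = 0 := by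
    have hX : f (rowCompression k u v w X) = 0 := hker (LinearMap.mem_range_self _ _)
    rw [rowCompression_apply, hf_apply] at hX
    rw [← hX]
    simp only [mulVec_add, mulVec_smul, dotProduct_add, dotProduct_smul, smul_eq_mul,
      Complex.add_re, Complex.re_ofReal_mul]
    ring
  refine ⟨f (1, 0, 0), β, γ, fun ⟨hβ0, hγ0⟩ => hf ?_, hzero⟩
  have hα : f (1, 0, 0) = 0 := by
    have hu' : (star u ⬝ᵥ u).re ≠ 0 := (Complex.pos_iff.1 (dotProduct_star_self_pos_iff.2 hu)).1.ne'
    simpa [hβ0, hγ0, Complex.re_ofReal_mul, hu'] using hzero ⟨1, one_mem_bandHerm⟩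
  refine LinearMap.ext fun ⟨a, b, c⟩ => ?_
  rw [hf_apply, hα, hβ0, hγ0]
  simp

theorem linearIndependent_pair_of_triple {K V : Type*} [Field K] [AddCommGroup V] [Module K V]
    {u v w : V} (h : LinearIndependent K ![u, v, w]) (a : K) {b c : K} (hbc : ¬(b = 0 ∧ c = 0)) :
    LinearIndependent K ![u, a • u + b • v + c • w] := by
  refine LinearIndependent.pair_iff.2 fun s t hst => ?_
  have h0 := Fintype.linearIndependent_iff.1 h ![s + t * a, t * b, t * c] <| by
    rw [← hst]
    simp only [Fin.sum_univ_three, cons_val]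
    module
  have hs := h0 0
  have hb := h0 1
  have hc := h0 2
  simp only [cons_val] at hs hb hc
  obtain rfl : t = 0 := by
    by_contra ht
    exact hbc ⟨(mul_eq_zero.1 hb).resolve_left ht, (mul_eq_zero.1 hc).resolve_left ht⟩
  simpa using hs

theorem finrank_bandTangent_add_five_le_of_linearIndependent (hk : 0 < k) (hA : A ∈ bandHerm n k)
    {u v w : Fin n → ℂ} (hu : A *ᵥ u = 0) (hv : A *ᵥ v = 0) (hw : A *ᵥ w = 0)
    (huvw : LinearIndependent ℂ ![u, v, w]) :
    finrank ℝ (bandTangent k A Set.univ) + 5 ≤ finrank ℝ (bandHerm n k) := by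
  by_cases hs : Function.Surjective (rowCompression k u v w)
  · have hdim : finrank ℝ (ℝ × ℂ × ℂ) = 5 := by simp
    rw [← hdim]
    refine finrank_add_le_of_le_ker (fun X hX => ?_) hs
    rw [LinearMap.mem_ker, rowCompression_apply,
      star_dotProduct_mulVec_eq_zero_of_mem_bandTangent hX hu hu,
      star_dotProduct_mulVec_eq_zero_of_mem_bandTangent hX hv hu,
      star_dotProduct_mulVec_eq_zero_of_mem_bandTangent hX hw hu]
    rfl
  · have hu0 : u ≠ 0 := huvw.ne_zero 0
    obtain ⟨α, β, γ, hne, hre⟩ :=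
      exists_re_eq_zero_of_not_surjective_rowCompression hu0 hs
    refine finrank_bandTangent_add_five_le_of_not_surjective hk hA hu ?_
      (linearIndependent_pair_of_triple huvw α hne) fun hsurj => ?_
    · simp [mulVec_add, mulVec_smul, hu, hv, hw]
    · obtain ⟨X, hX⟩ := hsurj (0, 0, 1)
      have hX1 : star u ⬝ᵥ X.1 *ᵥ ((α : ℂ) • u + β • v + γ • w) = 1 :=
        congrArg (fun p => p.2.2) hX
      exact one_ne_zero (α := ℝ) (by rw [← Complex.one_re, ← hX1, hre X])

end Corank

section DegenerateStrata

variable {n k : ℕ}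

/-- The shift `(A, s) ↦ A - s a • 1`, viewed on pairs consisting of a Hermitian band matrix and a
family of candidate eigenvalues of it. -/
noncomputable def spectralShift {κ : Type*} (k : ℕ) (a : κ) :
    bandHerm n k × (κ → ℝ) →ₗ[ℝ] bandHerm n k where
  toFun p := p.1 - p.2 a • ⟨1, one_mem_bandHerm⟩
  map_add' p q := by rw [Prod.fst_add, Prod.snd_add, Pi.add_apply, add_smul]; abel
  map_smul' c p := by
    simp only [Prod.smul_fst, Prod.smul_snd, Pi.smul_apply, smul_eq_mul, mul_smul, smul_sub,
      RingHom.id_apply]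

theorem spectralShift_apply {κ : Type*} (a : κ) (p : bandHerm n k × (κ → ℝ)) :
    spectralShift k a p = p.1 - p.2 a • ⟨1, one_mem_bandHerm⟩ := rfl

theorem dimH_image_fst_le_of_finrank_bandTangent {κ : Type*} [Finite κ]
    (S : Set (bandHerm n k × (κ → ℝ))) (d : ℕ)
    (h : ∀ p ∈ S, finrank ℝ (⨅ a, (bandTangent k (p.1.1 - p.2 a • 1) Set.univ).comap
      (spectralShift k a) : Submodule ℝ (bandHerm n k × (κ → ℝ))) ≤ d) :
    dimH (Prod.fst '' S) ≤ d := by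
  have := Fintype.ofFinite κ
  exact (LipschitzWith.prod_fst.dimH_image_le S).trans <|
    dimH_le_of_finrank_stratumTangent S (fun a => (bandHerm n k).subtype ∘ₗ spectralShift k a) d
      (fun a p _ => (mem_bandHerm.1 (spectralShift k a p).2).1) h

theorem dimH_finrank_bandTangent_add_five_le :
    dimH {A : bandHerm n k | ∃ s : ℝ, finrank ℝ (bandTangent k (A.1 - s • 1) Set.univ) + 5
      ≤ finrank ℝ (bandHerm n k)} ≤ (finrank ℝ (bandHerm n k) - 4 : ℕ) := by
  refine (dimH_mono ?_).trans (dimH_image_fst_le_of_finrank_bandTangent (κ := Unit)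
    {p | finrank ℝ (bandTangent k (p.1.1 - p.2 () • 1) Set.univ) + 5 ≤ finrank ℝ (bandHerm n k)}
    _ fun ⟨A, s⟩ h => ?_)
  · exact fun A ⟨s, hs⟩ => ⟨(A, fun _ => s), hs, rfl⟩
  obtain ⟨C, hC⟩ := (bandTangent k (A.1 - s () • 1) Set.univ).exists_isCompl
  let Ψ : C →ₗ[ℝ] bandHerm n k × (Unit → ℝ) := LinearMap.inl ℝ _ _ ∘ₗ C.subtype
  have hΨ (x : C) : spectralShift k () (Ψ x) = x.1 := by simp [Ψ, spectralShift]
  have hle := finrank_add_le_of_le_of_mem le_top Ψ (fun _ => Submodule.mem_top)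
    (W := (bandTangent k (A.1 - s () • 1) Set.univ).comap (spectralShift k ())) fun x hx =>
      Subtype.ext (Submodule.disjoint_def.1 hC.disjoint _ (hΨ x ▸ Submodule.mem_comap.1 hx) x.2)
  have hcompl := Submodule.finrank_add_eq_of_isCompl hC
  have hdim : finrank ℝ (bandHerm n k × (Unit → ℝ)) = finrank ℝ (bandHerm n k) + 1 := by simp
  rw [finrank_top, hdim] at hle
  rw [iInf_unique]
  have h' : finrank ℝ (bandTangent k (A.1 - s () • 1) Set.univ) + 5 ≤
    finrank ℝ (bandHerm n k) := h
  change finrank ℝ ((bandTangent k (A.1 - s () • 1) Set.univ).comap (spectralShift k ())) ≤ _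
  omega

variable {ι : Type*} [Fintype ι] [DecidableEq ι]

/-- The anticommutator of `A` with the `i`-th diagonal matrix unit. Its sesquilinear form vanishes
on the kernel of `A` but not on the other eigenspaces, which makes it a direction that moves one
multiple eigenvalue while keeping another one. -/
def diagProbe (A : Matrix ι ι ℂ) (i : ι) : Matrix ι ι ℂ :=
  Matrix.single i i 1 * A + A * Matrix.single i i 1

theorem diagProbe_mem_bandHerm {A : Matrix (Fin n) (Fin n) ℂ} (hA : A ∈ bandHerm n k)
    (i : Fin n) : diagProbe A i ∈ bandHerm n k := by
  have hA' := mem_bandHerm.1 hA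
  refine mem_bandHerm.2 ⟨?_, fun a b hab => hA'.2 a b fun h0 => hab ?_⟩
  · simp [IsHermitian, diagProbe, hA'.1.eq, add_comm]
  · have hleft : (Matrix.single i i (1 : ℂ) * A) a b = 0 := by
      by_cases ha : a = i
      · rw [ha, single_mul_apply_same, ← ha, h0, mul_zero]
      · exact single_mul_apply_of_ne _ _ _ _ _ ha _
    have hright : (A * Matrix.single i i (1 : ℂ)) a b = 0 := by
      by_cases hb : b = i
      · rw [hb, mul_single_apply_same, ← hb, h0, zero_mul]
      · exact mul_single_apply_of_ne _ _ _ _ _ hb _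
    rw [diagProbe, Matrix.add_apply, hleft, hright, add_zero]

theorem star_dotProduct_diagProbe_mulVec {A : Matrix ι ι ℂ} (hA : A.IsHermitian) (i : ι) {r : ℝ}
    {x y : ι → ℂ} (hx : A *ᵥ x = r • x) (hy : A *ᵥ y = r • y) :
    star y ⬝ᵥ diagProbe A i *ᵥ x = 2 * r * (star (y i) * x i) := by
  have hsingle : star y ⬝ᵥ Matrix.single i i (1 : ℂ) *ᵥ x = star (y i) * x i := by
    rw [single_mulVec, ← Pi.single]
    simp
  have hyA : star y ᵥ* A = r • star y := by
    rw [← hA.eq, ← star_mulVec, hy, star_smul, star_trivial]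
  rw [diagProbe, add_mulVec, dotProduct_add, ← mulVec_mulVec, ← mulVec_mulVec, hx, mulVec_smul,
    dotProduct_smul, dotProduct_mulVec (star y) A, hyA, smul_dotProduct, hsingle, Complex.real_smul]
  ring

theorem sub_smul_one_mulVec {A : Matrix ι ι ℂ} {s : ℝ} {x : ι → ℂ} (hx : A *ᵥ x = s • x)
    (t : ℝ) : (A - t • 1) *ᵥ x = (s - t) • x := by
  rw [sub_mulVec, smul_mulVec, one_mulVec, hx, sub_smul]

open scoped ComplexOrder in
theorem eq_zero_of_diagProbe_sub_vanishes {A : Matrix ι ι ℂ} {s t : ℝ}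
    (hA : (A - t • 1).IsHermitian) (hst : s ≠ t) {v w : ι → ℂ} (hv : A *ᵥ v = s • v)
    (hw : A *ᵥ w = s • w) (hvw : LinearIndependent ℂ ![v, w]) {i : ι} (hi : v i ≠ 0) {τ c : ℝ}
    (h : ∀ x, A *ᵥ x = s • x → star x ⬝ᵥ (τ • diagProbe (A - t • 1) i - c • 1) *ᵥ x = 0) :
    τ = 0 ∧ c = 0 := by
  have hform (x) (hx : A *ᵥ x = s • x) :
      τ * (2 * (s - t : ℝ) * (star (x i) * x i)) - c * (star x ⬝ᵥ x) = 0 := by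
    have hx' := sub_smul_one_mulVec hx t
    rw [← h x hx, ← star_dotProduct_diagProbe_mulVec hA i hx' hx', sub_mulVec, smul_mulVec,
      smul_mulVec, one_mulVec, dotProduct_sub, dotProduct_smul, dotProduct_smul,
      Complex.real_smul, Complex.real_smul]
  let x := w i • v - v i • w
  have hx : A *ᵥ x = s • x := by
    simp only [x, mulVec_sub, mulVec_smul, hv, hw]
    module
  have hx0 : x ≠ 0 := fun h0 => hi <| by
    have := LinearIndependent.pair_iff.1 hvw (w i) (-v i) (by rw [← h0]; module)
    exact neg_eq_zero.1 this.2
  have hc : c = 0 := by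
    have := hform x hx
    rw [show x i = 0 by simp [x, mul_comm]] at this
    simpa [hx0, dotProduct_star_self_eq_zero] using this
  have hτ := hform v hv
  rw [hc] at hτ
  exact ⟨by simpa [sub_eq_zero, hst, hi] using hτ, hc⟩

theorem compression_diagProbe_eq_zero {A : bandHerm n k} {v w : Fin n → ℂ} (hv : A.1 *ᵥ v = 0)
    (hw : A.1 *ᵥ w = 0) (i : Fin n) :
    compression k v w ⟨_, diagProbe_mem_bandHerm A.2 i⟩ = 0 := by
  have hA := (mem_bandHerm.1 A.2).1
  have hv' : A.1 *ᵥ v = (0 : ℝ) • v := by rw [hv, zero_smul]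
  have hw' : A.1 *ᵥ w = (0 : ℝ) • w := by rw [hw, zero_smul]
  rw [compression_apply, star_dotProduct_diagProbe_mulVec hA i hv' hv',
    star_dotProduct_diagProbe_mulVec hA i hw' hw', star_dotProduct_diagProbe_mulVec hA i hw' hv']
  simp

theorem eq_zero_of_probe_mem_bandTangent {A : bandHerm n k} {s t : ℝ} (hst : s ≠ t)
    {v w v' w' : Fin n → ℂ} (hv : A.1 *ᵥ v = s • v) (hw : A.1 *ᵥ w = s • w)
    (hvw : LinearIndependent ℂ ![v, w]) (hv' : A.1 *ᵥ v' = t • v') (hw' : A.1 *ᵥ w' = t • w')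
    {r : ℝ × ℝ × ℂ →ₗ[ℝ] bandHerm n k} (hr : compression k v' w' ∘ₗ r = LinearMap.id) {i : Fin n}
    (hi : v i ≠ 0) {Y : bandHerm n k} (hY : Y.1 = diagProbe (A.1 - t • 1) i)
    {q : ℝ × ℝ × ℂ} {τ c : ℝ}
    (ht : r q + τ • Y ∈ bandTangent k (A.1 - t • 1) Set.univ)
    (hs : r q + τ • Y - c • ⟨1, one_mem_bandHerm⟩ ∈ bandTangent k (A.1 - s • 1) Set.univ) :
    q = 0 ∧ τ = 0 ∧ c = 0 := by
  have hker {u : ℝ} {x : Fin n → ℂ} (hx : A.1 *ᵥ x = u • x) : (A.1 - u • 1) *ᵥ x = 0 := by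
    rw [sub_smul_one_mulVec hx, sub_self, zero_smul]
  have hB := sub_smul_one_mem_bandHerm A.2 t
  obtain rfl : Y = ⟨_, diagProbe_mem_bandHerm hB i⟩ := Subtype.ext hY
  obtain rfl : q = 0 := by
    have h := bandTangent_le_ker_compression (mem_kernelOn_univ.2 (hker hv'))
      (mem_kernelOn_univ.2 (hker hw')) ht
    rw [LinearMap.mem_ker, map_add, map_smul,
      compression_diagProbe_eq_zero (A := ⟨_, hB⟩) (hker hv') (hker hw'), smul_zero, add_zero] at h
    rw [← h]
    exact (LinearMap.congr_fun hr q).symm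
  rw [map_zero, zero_add] at hs
  exact ⟨rfl, eq_zero_of_diagProbe_sub_vanishes (mem_bandHerm.1 hB).1 hst hv hw hvw hi
    fun x hx => star_dotProduct_mulVec_eq_zero_of_mem_bandTangent hs (hker hx) (hker hx)⟩

theorem finrank_add_four_le_of_two_double_eigenvalues {A : bandHerm n k} {s : Fin 2 → ℝ}
    (hs : s 0 ≠ s 1) {v w v' w' : Fin n → ℂ} (hv : A.1 *ᵥ v = s 0 • v) (hw : A.1 *ᵥ w = s 0 • w)
    (hvw : LinearIndependent ℂ ![v, w]) (hv' : A.1 *ᵥ v' = s 1 • v') (hw' : A.1 *ᵥ w' = s 1 • w')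
    (hsurj : Function.Surjective (compression k v' w')) :
    finrank ℝ (⨅ a, (bandTangent k (A.1 - s a • 1) Set.univ).comap (spectralShift k a) :
      Submodule ℝ (bandHerm n k × (Fin 2 → ℝ))) + 4 ≤ finrank ℝ (bandHerm n k) := by
  obtain ⟨i, hi⟩ := Function.ne_iff.1 (hvw.ne_zero 0)
  obtain ⟨r, hr⟩ := (compression k v' w').exists_rightInverse_of_surjective
    (LinearMap.range_eq_top.2 hsurj)
  let Y : bandHerm n k := ⟨_, diagProbe_mem_bandHerm (sub_smul_one_mem_bandHerm A.2 (s 1)) i⟩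
  let Ψ : (ℝ × ℝ × ℂ) × ℝ × ℝ →ₗ[ℝ] bandHerm n k × (Fin 2 → ℝ) :=
    (r.coprod (LinearMap.toSpanSingleton ℝ _ Y ∘ₗ LinearMap.fst ℝ ℝ ℝ)).prod
      (LinearMap.single ℝ _ 0 ∘ₗ LinearMap.snd ℝ ℝ ℝ ∘ₗ LinearMap.snd ℝ _ _)
  have hΨ₀ (q τ c) : spectralShift k 0 (Ψ (q, τ, c)) =
      r q + τ • Y - c • ⟨1, one_mem_bandHerm⟩ := rfl
  have hΨ₁ (q τ c) : spectralShift k 1 (Ψ (q, τ, c)) = r q + τ • Y := by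
    simp [Ψ, spectralShift_apply]
  have hle := finrank_add_le_of_le_of_mem le_top Ψ (fun _ => Submodule.mem_top)
    (W := ⨅ a, (bandTangent k (A.1 - s a • 1) Set.univ).comap (spectralShift k a)) ?_
  · have h6 : finrank ℝ ((ℝ × ℝ × ℂ) × ℝ × ℝ) = 6 := by simp
    have h2 : finrank ℝ (bandHerm n k × (Fin 2 → ℝ)) = finrank ℝ (bandHerm n k) + 2 := by simp
    rw [finrank_top, h6, h2] at hle
    omega
  · rintro ⟨q, τ, c⟩ hmem
    rw [Submodule.mem_iInf] at hmem
    have h₀ := hmem 0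
    have h₁ := hmem 1
    rw [Submodule.mem_comap] at h₀ h₁
    obtain ⟨rfl, rfl, rfl⟩ := eq_zero_of_probe_mem_bandTangent hs hv hw hvw hv' hw' hr hi (Y := Y)
      rfl (hΨ₁ q τ c ▸ h₁) (hΨ₀ q τ c ▸ h₀)
    rfl

theorem dimH_two_double_eigenvalues_le :
    dimH {A : bandHerm n k | ∃ s t : ℝ, s ≠ t ∧
      (∃ v w, LinearIndependent ℂ ![v, w] ∧ A.1 *ᵥ v = s • v ∧ A.1 *ᵥ w = s • w) ∧
      ∃ v w, A.1 *ᵥ v = t • v ∧ A.1 *ᵥ w = t • w ∧ Function.Surjective (compression k v w)} ≤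
        (finrank ℝ (bandHerm n k) - 4 : ℕ) := by
  refine (dimH_mono ?_).trans (dimH_image_fst_le_of_finrank_bandTangent (κ := Fin 2)
    {p | p.2 0 ≠ p.2 1 ∧
      (∃ v w, LinearIndependent ℂ ![v, w] ∧ p.1.1 *ᵥ v = p.2 0 • v ∧ p.1.1 *ᵥ w = p.2 0 • w) ∧
      ∃ v w, p.1.1 *ᵥ v = p.2 1 • v ∧ p.1.1 *ᵥ w = p.2 1 • w ∧
        Function.Surjective (compression k v w)} _ fun p hp => ?_)
  · exact fun A ⟨s, t, h⟩ => ⟨(A, ![s, t]), h, rfl⟩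
  · obtain ⟨hs, ⟨v, w, hvw, hv, hw⟩, v', w', hv', hw', hsurj⟩ := hp
    exact Nat.le_sub_of_add_le
      (finrank_add_four_le_of_two_double_eigenvalues hs hv hw hvw hv' hw' hsurj)

end DegenerateStrata

section Finrank

variable {n k : ℕ}

/-- The index pairs in the band that lie strictly above the diagonal. -/
abbrev UpperBand (n k : ℕ) : Type :=
  {p : Fin n × Fin n // p.1 < p.2 ∧ (p.2 : ℕ) ≤ p.1 + k}

/-- The diagonal entries of a Hermitian band matrix, which are real, and its entries above the
diagonal. -/
noncomputable def bandCoordinates (n k : ℕ) :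
    bandHerm n k →ₗ[ℝ] (Fin n → ℝ) × (UpperBand n k → ℂ) where
  toFun X := (fun i => (X.1 i i).re, fun p => X.1 p.1.1 p.1.2)
  map_add' X Y := by ext <;> simp
  map_smul' c X := by ext <;> simp

theorem bandCoordinates_injective : Function.Injective (bandCoordinates n k) := by
  refine (injective_iff_map_eq_zero _).2 fun X hX => ?_
  have hXh := (mem_bandHerm.1 X.2).1
  have hdiag (i) : X.1 i i = 0 := by
    rw [← hXh.coe_re_apply_self i]
    exact congrArg Complex.ofReal (congrFun (congrArg Prod.fst hX) i)
  have hupper (i j) (hij : i < j) : X.1 i j = 0 := by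
    by_cases hk : (j : ℕ) ≤ i + k
    · exact congrFun (congrArg Prod.snd hX) ⟨(i, j), hij, hk⟩
    · exact apply_eq_zero_of_mem_bandHerm X.2 (by omega)
  ext i j
  obtain hij | rfl | hji := lt_trichotomy i j
  · exact hupper i j hij
  · exact hdiag i
  · rw [← hXh.apply, hupper j i hji, star_zero]
    rfl

theorem bandCoordinates_surjective : Function.Surjective (bandCoordinates n k) := by
  rintro ⟨d, c⟩
  let U : Matrix (Fin n) (Fin n) ℂ :=
    of fun i j => if h : i < j ∧ (j : ℕ) ≤ i + k then c ⟨(i, j), h⟩ else 0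
  have hU_band (i j : Fin n) (h : ¬(i < j ∧ (j : ℕ) ≤ i + k)) : U i j = 0 := dif_neg h
  let D : Matrix (Fin n) (Fin n) ℂ := diagonal fun i => (d i : ℂ)
  have hD : D ∈ bandHerm n k := diagonal_mem_bandHerm (by ext; simp)
  have hU : U + Uᴴ ∈ bandHerm n k := by
    refine mem_bandHerm.2 ⟨isHermitian_add_transpose_self U, fun i j hij => ?_⟩
    by_contra hk
    rw [Matrix.add_apply, conjTranspose_apply, hU_band i j (by omega),
      hU_band j i (by omega)] at hij
    simp at hij
  refine ⟨⟨D + (U + Uᴴ), add_mem hD hU⟩, Prod.ext (funext fun i => ?_) (funext fun p => ?_)⟩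
  · simp [bandCoordinates, D, hU_band i i (by simp)]
  · obtain ⟨⟨i, j⟩, hij⟩ := p
    have hUij : U i j = c ⟨(i, j), hij⟩ := dif_pos hij
    simp [bandCoordinates, D, hij.1.ne, hU_band j i (fun h => h.1.asymm hij.1), hUij]

theorem sum_range_min {n k : ℕ} (h : k < n) :
    (∑ i ∈ Finset.range n, min i k) * 2 + k * (k + 1) = 2 * n * k := by
  induction n, h using Nat.le_induction with
  | base =>
    rw [Finset.sum_congr rfl fun i hi => min_eq_left (Finset.mem_range_succ_iff.1 hi),
      Finset.sum_range_id_mul_two, Nat.succ_sub_one, Nat.succ_eq_add_one]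
    ring
  | succ n h ih =>
    rw [Finset.sum_range_succ, min_eq_right (by omega)]
    linarith

theorem card_upperBand (n k : ℕ) :
    Fintype.card (UpperBand n k) = ∑ i ∈ Finset.range n, min i k := by
  rw [Fintype.card_subtype, Finset.card_filter, Fintype.sum_prod_type_right, Finset.sum_range]
  refine Finset.sum_congr rfl fun j _ => ?_
  rw [← Finset.card_filter]
  have : Finset.univ.filter (fun i : Fin n => i < j ∧ (j : ℕ) ≤ i + k)
      = Finset.Ico ⟨j - k, by omega⟩ j := by
    ext i
    simp only [Finset.mem_filter_univ, Finset.mem_Ico, Fin.le_def]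
    omega
  rw [this, Fin.card_Ico]
  exact Nat.sub_sub_eq_min j k

theorem finrank_bandHerm (hkn : k < n) :
    (finrank ℝ (bandHerm n k) : ℤ) = n * (2 * k + 1) - k * (k + 1) := by
  have hcoord := (LinearEquiv.ofBijective (bandCoordinates n k)
    ⟨bandCoordinates_injective, bandCoordinates_surjective⟩).finrank_eq
  have hdim : finrank ℝ ((Fin n → ℝ) × (UpperBand n k → ℂ)) =
      n + (∑ i ∈ Finset.range n, min i k) * 2 := by
    rw [finrank_prod, finrank_fintype_fun_eq_card, Fintype.card_fin, finrank_pi_fintype,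
      Finset.sum_const, Finset.card_univ, card_upperBand, Complex.finrank_real_complex, smul_eq_mul]
  have hsum := sum_range_min hkn
  rw [hcoord, hdim]
  zify at hsum
  push_cast
  linarith

theorem four_le_finrank_bandHerm (hk : 0 < k) (hkn : k < n) : 4 ≤ finrank ℝ (bandHerm n k) := by
  have h := finrank_bandHerm hkn
  zify
  nlinarith

end Finrank

section MultipleEigenvalues

variable {m : Type*} [Fintype m]

theorem exists_isometry_mul_eq_zero {κ : Type*} [Fintype κ] [DecidableEq κ] {B : Matrix m m ℂ}
    (h : B.rank + Fintype.card κ ≤ Fintype.card m) :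
    ∃ V : Matrix m κ ℂ, Vᴴ * V = 1 ∧ B * V = 0 := by
  classical
  have hker : Fintype.card κ ≤ finrank ℂ (LinearMap.ker (toEuclideanLin B)) := by
    have hrank : finrank ℂ (LinearMap.range (toEuclideanLin B)) = B.rank :=
      (rank_eq_finrank_range_toLin B (PiLp.basisFun 2 ℂ m) (PiLp.basisFun 2 ℂ m)).symm
    have := LinearMap.finrank_range_add_finrank_ker (toEuclideanLin B)
    rw [hrank, finrank_euclideanSpace] at this
    omega
  let b := stdOrthonormalBasis ℂ (LinearMap.ker (toEuclideanLin B))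
  let e : κ ↪ Fin (finrank ℂ (LinearMap.ker (toEuclideanLin B))) :=
    (Fintype.equivFin κ).toEmbedding.trans (Fin.castLEEmb hker)
  have hb := orthonormal_iff_ite.1 (b.orthonormal.comp e e.injective)
  refine ⟨of fun i a => (b (e a)).1 i, ?_, ?_⟩
  · ext a c
    have hac := hb a c
    rw [Submodule.coe_inner, EuclideanSpace.inner_eq_star_dotProduct, dotProduct_comm] at hac
    rwa [one_apply]
  · ext i a
    exact congrArg (fun x : EuclideanSpace ℂ m => x i) (LinearMap.mem_ker.1 (b (e a)).2)

theorem isClosed_setOf_rank_add_le (r : ℕ) :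
    IsClosed {B : Matrix m m ℂ | B.rank + r ≤ Fintype.card m} := by
  classical
  have hopen : IsOpen {B : Matrix m m ℂ | Fintype.card m + 1 - r ≤ B.rank} := by
    let L : Matrix m m ℂ →ₗ[ℂ] (EuclideanSpace ℂ m →L[ℂ] EuclideanSpace ℂ m) :=
      LinearMap.toContinuousLinearMap.toLinearMap ∘ₗ toEuclideanLin.toLinearMap
    convert! (isOpen_setOfPred_nat_le_rank (Fintype.card m + 1 - r)).preimage
      L.continuous_of_finiteDimensional using 1
    ext B
    rw [Set.mem_ofPred_eq,
      rank_eq_finrank_range_toLin B (PiLp.basisFun 2 ℂ m) (PiLp.basisFun 2 ℂ m),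
      ← Nat.cast_le (α := Cardinal), finrank_eq_rank]
    rfl
  rw [← isOpen_compl_iff]
  convert! hopen using 1
  ext B
  simp only [Set.mem_compl_iff, Set.mem_ofPred_eq]
  omega

theorem norm_le_of_mulVec_eq_smul {A : Matrix m m ℂ} {v : m → ℂ} {s : ℂ} (hv : v ≠ 0)
    (h : A *ᵥ v = s • v) : ‖s‖ ≤ Fintype.card m * ‖A‖ := by
  refine le_of_mul_le_mul_right ?_ (norm_pos_iff.2 hv)
  rw [← norm_smul, ← h]
  refine (pi_norm_le_iff_of_nonneg (by positivity)).2 fun i => ?_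
  calc ‖(A *ᵥ v) i‖ ≤ ∑ j, ‖A i j * v j‖ := norm_sum_le _ _
    _ ≤ ∑ _j : m, ‖A‖ * ‖v‖ := Finset.sum_le_sum fun j _ => by
      rw [norm_mul]
      gcongr
      · exact norm_entry_le_entrywise_sup_norm A
      · exact norm_le_pi_norm v j
    _ = Fintype.card m * ‖A‖ * ‖v‖ := by
      rw [Finset.sum_const, Finset.card_univ, nsmul_eq_mul, mul_assoc]

theorem exists_mulVec_eq_smul_of_rank_lt [DecidableEq m] {A : Matrix m m ℂ} {s : ℝ}
    (h : (A - s • (1 : Matrix m m ℂ)).rank < Fintype.card m) :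
    ∃ v ≠ 0, A *ᵥ v = (s : ℂ) • v := by
  obtain ⟨v, hv, hAv⟩ := exists_mulVec_eq_zero_iff.2 <| by_contra fun hdet =>
    h.ne (rank_of_isUnit _ ((isUnit_iff_isUnit_det _).2 (isUnit_iff_ne_zero.2 hdet)))
  rw [sub_mulVec, smul_mulVec, one_mulVec, sub_eq_zero] at hAv
  exact ⟨v, hv, hAv⟩

theorem eventually_mem_of_rank_add_le [DecidableEq m] {A₀ : Matrix m m ℂ} {r : ℕ}
    (hr : 0 < r) {W : Set ℝ} (hW : IsOpen W)
    (h : ∀ s : ℝ, (A₀ - s • (1 : Matrix m m ℂ)).rank + r ≤ Fintype.card m → s ∈ W) :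
    ∀ᶠ A in 𝓝 A₀, ∀ s : ℝ,
      (A - s • (1 : Matrix m m ℂ)).rank + r ≤ Fintype.card m → s ∈ W := by
  let R : ℝ := Fintype.card m * (‖A₀‖ + 1)
  have hcompact : IsCompact (Set.Icc (-R) R \ W) := isCompact_Icc.diff hW
  have hclosed : IsClosed {p : Matrix m m ℂ × ℝ |
      (p.1 - p.2 • (1 : Matrix m m ℂ)).rank + r ≤ Fintype.card m} :=
    (isClosed_setOf_rank_add_le r).preimage (by fun_prop)
  have hbounded : ∀ᶠ A in 𝓝 A₀, ∀ s ∈ Set.Icc (-R) R \ W,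
      ¬((A - s • (1 : Matrix m m ℂ)).rank + r ≤ Fintype.card m) :=
    hcompact.eventually_forall_of_forall_eventually fun s hs =>
      hclosed.isOpen_compl.mem_nhds fun hsr => hs.2 (h s hsr)
  have hnorm : ∀ᶠ A in 𝓝 A₀, ‖A‖ < ‖A₀‖ + 1 :=
    continuous_norm.continuousAt.eventually_lt continuousAt_const (lt_add_one _)
  filter_upwards [hbounded, hnorm] with A hA hAR s hs
  by_contra hsW
  obtain ⟨v, hv, hvs⟩ := exists_mulVec_eq_smul_of_rank_lt ((Nat.lt_add_of_pos_right hr).trans_le hs)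
  have hsR : |s| ≤ R := by
    rw [← Real.norm_eq_abs, ← Complex.norm_real]
    exact (norm_le_of_mulVec_eq_smul hv hvs).trans
      (mul_le_mul_of_nonneg_left hAR.le (Nat.cast_nonneg _))
  exact hA s ⟨abs_le.1 hsR, hsW⟩ hs

open scoped ComplexOrder in
theorem exists_eigenvalue_eq_ofReal {A : Matrix m m ℂ} (hA : A.IsHermitian) {v : m → ℂ} {μ : ℂ}
    (hv : v ≠ 0) (h : A *ᵥ v = μ • v) : ∃ s : ℝ, μ = s := by
  have hreal := star_dotProduct_mulVec_comm hA v v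
  rw [h, dotProduct_smul, smul_eq_mul, star_mul', ← star_dotProduct] at hreal
  exact Complex.conj_eq_iff_real.1
    (mul_right_cancel₀ (dotProduct_star_self_eq_zero.not.2 hv) hreal.symm)

theorem rank_sub_smul_one_add_finrank_eigenspace [DecidableEq m] (A : Matrix m m ℂ) (μ : ℂ) :
    (A - μ • (1 : Matrix m m ℂ)).rank + finrank ℂ (End.eigenspace (toLin' A) μ)
      = Fintype.card m := by
  rw [End.eigenspace_def, show toLin' A - μ • 1 = toLin' (A - μ • 1) by
    rw [map_sub, map_smul, toLin'_one]; rfl]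
  exact (LinearMap.finrank_range_add_finrank_ker _).trans (finrank_fintype_fun_eq_card ℂ)

theorem isDerogatory_iff {n : ℕ} {A : Matrix (Fin n) (Fin n) ℂ} (hA : A.IsHermitian) :
    IsDerogatory A ↔ ∃ s : ℝ, (A - s • (1 : Matrix (Fin n) (Fin n) ℂ)).rank + 2 ≤ n := by
  have hrank (s : ℝ) : (A - s • (1 : Matrix (Fin n) (Fin n) ℂ)).rank
      + finrank ℂ (End.eigenspace (toLin' A) s) = n :=
    (rank_sub_smul_one_add_finrank_eigenspace A s).trans (Fintype.card_fin n)
  constructor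
  · rintro ⟨μ, hμ⟩
    obtain ⟨v, hv, hv0⟩ := Submodule.exists_mem_ne_zero_of_ne_bot
      (Submodule.one_le_finrank_iff.1 hμ.le)
    obtain ⟨s, rfl⟩ := exists_eigenvalue_eq_ofReal hA hv0 (End.mem_eigenspace_iff.1 hv)
    exact ⟨s, by have := hrank s; omega⟩
  · rintro ⟨s, hs⟩
    exact ⟨s, by have := hrank s; omega⟩

end MultipleEigenvalues

section CompressedResolvent

variable {m : Type*} [Fintype m] [DecidableEq m]

section Inverse

variable {𝕜 : Type*} [RCLike 𝕜]

theorem toEuclideanCLM_inv (A : Matrix m m 𝕜) :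
    toEuclideanCLM (n := m) (𝕜 := 𝕜) A⁻¹ = Ring.inverse (toEuclideanCLM (n := m) (𝕜 := 𝕜) A) := by
  let e := toEuclideanCLM (n := m) (𝕜 := 𝕜)
  change e A⁻¹ = Ring.inverse (e A)
  by_cases hA : IsUnit A
  · rw [← one_mul (e _), ← Ring.inverse_mul_cancel _ (hA.map e), mul_assoc, ← map_mul,
      mul_nonsing_inv A ((isUnit_iff_isUnit_det A).1 hA), map_one, mul_one]
  · rw [nonsing_inv_eq_ringInverse, Ring.inverse_non_unit _ hA, map_zero,
      Ring.inverse_non_unit _ ((isUnit_map_iff e A).not.2 hA)]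

/-- `Matrix.toEuclideanCLM` as a continuous linear equivalence for the entrywise norm of
matrices. -/
noncomputable def euclideanCLMEquiv (m 𝕜 : Type*) [Fintype m] [DecidableEq m] [RCLike 𝕜] :
    Matrix m m 𝕜 ≃L[𝕜] (EuclideanSpace 𝕜 m →L[𝕜] EuclideanSpace 𝕜 m) :=
  (toEuclideanCLM (n := m) (𝕜 := 𝕜)).toAlgEquiv.toLinearEquiv.toContinuousLinearEquiv

theorem inv_eq_euclideanCLMEquiv_symm (A : Matrix m m 𝕜) :
    A⁻¹ = (euclideanCLMEquiv m 𝕜).symm (Ring.inverse (euclideanCLMEquiv m 𝕜 A)) :=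
  ((euclideanCLMEquiv m 𝕜).symm_apply_eq.2 (toEuclideanCLM_inv A).symm).symm

theorem contDiffAt_matrix_inv {A : Matrix m m 𝕜} (hA : IsUnit A) :
    ContDiffAt 𝕜 ω (fun B : Matrix m m 𝕜 => B⁻¹) A := by
  obtain ⟨u, hu : u = euclideanCLMEquiv m 𝕜 A⟩ := hA.map (toEuclideanCLM (n := m) (𝕜 := 𝕜))
  have hinv := contDiffAt_ringInverse (n := ω) 𝕜 u
  rw [hu] at hinv
  simp only [inv_eq_euclideanCLMEquiv_symm]
  exact (euclideanCLMEquiv m 𝕜).symm.contDiff.contDiffAt.comp A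
    (hinv.comp A (euclideanCLMEquiv m 𝕜).contDiff.contDiffAt)

theorem hasFDerivAt_matrix_inv {A : Matrix m m 𝕜} (hA : IsUnit A) :
    HasFDerivAt (fun B : Matrix m m 𝕜 => B⁻¹)
      (-(LinearMap.mulLeftRight 𝕜 (A⁻¹, A⁻¹)).toContinuousLinearMap) A := by
  let e := euclideanCLMEquiv m 𝕜
  obtain ⟨u, hu : u = e A⟩ := hA.map (toEuclideanCLM (n := m) (𝕜 := 𝕜))
  have hinv := hasFDerivAt_ringInverse (𝕜 := 𝕜) u
  have heA : Ring.inverse (e A) = e A⁻¹ := (toEuclideanCLM_inv A).symm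
  rw [← Ring.inverse_unit, hu, heA] at hinv
  have hmul : ∀ B C, e (B * C) = e B * e C := map_mul (toEuclideanCLM (n := m) (𝕜 := 𝕜))
  have hcomp := e.symm.hasFDerivAt.comp A (hinv.comp A e.hasFDerivAt)
  refine (hcomp.congr_fderiv ?_).congr_of_eventuallyEq (.of_forall inv_eq_euclideanCLMEquiv_symm)
  ext1 X
  change e.symm (-(e A⁻¹ * e X * e A⁻¹)) = -(A⁻¹ * X * A⁻¹)
  rw [e.symm_apply_eq, map_neg, hmul, hmul]

end Inverse

variable {κ : Type*} [Fintype κ]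

/-- The compression by `V` of the inverse of the bordered matrix `B + V Vᴴ`. Unlike the inverse of
`B`, it is smooth near those `B` whose kernel is spanned by the columns of `V`, and it equals `1`
precisely when the corank of `B` is at least the number of columns of `V`. -/
noncomputable def compressedResolvent (V : Matrix m κ ℂ) (B : Matrix m m ℂ) : Matrix κ κ ℂ :=
  Vᴴ * (B + V * Vᴴ)⁻¹ * V

theorem isHermitian_compressedResolvent (V : Matrix m κ ℂ) {B : Matrix m m ℂ}
    (hB : B.IsHermitian) : (compressedResolvent V B).IsHermitian :=
  isHermitian_conjTranspose_mul_mul V (hB.add (isHermitian_mul_conjTranspose_self V)).inv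

theorem contDiffAt_compressedResolvent {V : Matrix m κ ℂ} {B : Matrix m m ℂ}
    (hB : IsUnit (B + V * Vᴴ)) : ContDiffAt ℂ ω (compressedResolvent V) B :=
  let L := (mulRightLinearMap κ ℂ V ∘ₗ mulLeftLinearMap m ℂ Vᴴ).toContinuousLinearMap
  L.contDiff.contDiffAt.comp B
    ((contDiffAt_matrix_inv hB).comp B (contDiff_id.add contDiff_const).contDiffAt)

variable [DecidableEq κ]

theorem compressedResolvent_eq_one_iff {V : Matrix m κ ℂ} {B : Matrix m m ℂ}
    (hB : IsUnit (B + V * Vᴴ)) :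
    compressedResolvent V B = 1 ↔ B.rank + Fintype.card κ ≤ Fintype.card m := by
  have hdet := (isUnit_iff_isUnit_det _).1 hB
  constructor
  · intro h
    have hker : B * ((B + V * Vᴴ)⁻¹ * V) = 0 := by
      have hinv : (B + V * Vᴴ) * ((B + V * Vᴴ)⁻¹ * V) = V := by
        rw [← Matrix.mul_assoc, mul_nonsing_inv _ hdet, Matrix.one_mul]
      rwa [Matrix.add_mul, Matrix.mul_assoc V, ← Matrix.mul_assoc Vᴴ,
        ← compressedResolvent, h, Matrix.mul_one, add_eq_right] at hinv
    have hrank : Fintype.card κ ≤ ((B + V * Vᴴ)⁻¹ * V).rank := by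
      rw [← rank_one (R := ℂ) (n := κ), ← h, compressedResolvent, Matrix.mul_assoc]
      exact rank_mul_le_right _ _
    exact (Nat.add_le_add_left hrank _).trans (rank_add_rank_le_card_of_mul_eq_zero hker)
  · intro h
    obtain ⟨W, hW, hBW⟩ := exists_isometry_mul_eq_zero (κ := κ) h
    have hWV : (B + V * Vᴴ)⁻¹ * (V * (Vᴴ * W)) = W := by
      have hVW : V * (Vᴴ * W) = (B + V * Vᴴ) * W := by
        rw [Matrix.add_mul, hBW, zero_add, Matrix.mul_assoc]
      rw [hVW, ← Matrix.mul_assoc, nonsing_inv_mul _ hdet, Matrix.one_mul]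
    have hunit : IsUnit (Vᴴ * W) := by
      refine .of_mul_eq_one_right (Wᴴ * ((B + V * Vᴴ)⁻¹ * V)) ?_
      rw [Matrix.mul_assoc, Matrix.mul_assoc _ V, hWV, hW]
    refine hunit.mul_right_cancel ?_
    rw [Matrix.one_mul, compressedResolvent, Matrix.mul_assoc, Matrix.mul_assoc, hWV]

theorem inv_add_mul_conjTranspose_mul {V : Matrix m κ ℂ} {B : Matrix m m ℂ}
    (hV : Vᴴ * V = 1) (hBV : B * V = 0) (hB : IsUnit (B + V * Vᴴ)) : (B + V * Vᴴ)⁻¹ * V = V := by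
  have hV' : (B + V * Vᴴ) * V = V := by
    rw [Matrix.add_mul, hBV, zero_add, Matrix.mul_assoc, hV, Matrix.mul_one]
  calc (B + V * Vᴴ)⁻¹ * V = (B + V * Vᴴ)⁻¹ * ((B + V * Vᴴ) * V) := by rw [hV']
    _ = V := by
      rw [← Matrix.mul_assoc, nonsing_inv_mul _ ((isUnit_iff_isUnit_det _).1 hB), Matrix.one_mul]

theorem hasFDerivAt_compressedResolvent {V : Matrix m κ ℂ} {B : Matrix m m ℂ}
    (hBh : B.IsHermitian) (hV : Vᴴ * V = 1) (hBV : B * V = 0) (hB : IsUnit (B + V * Vᴴ)) :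
    HasFDerivAt (compressedResolvent V)
      (-(mulRightLinearMap κ ℂ V ∘ₗ mulLeftLinearMap m ℂ Vᴴ).toContinuousLinearMap) B := by
  have hright := inv_add_mul_conjTranspose_mul hV hBV hB
  have hleft : Vᴴ * (B + V * Vᴴ)⁻¹ = Vᴴ := by
    rw [← (hBh.add (isHermitian_mul_conjTranspose_self V)).inv.eq, ← conjTranspose_mul, hright]
  have hcomp := (mulRightLinearMap κ ℂ V ∘ₗ
    mulLeftLinearMap m ℂ Vᴴ).toContinuousLinearMap.hasFDerivAt.comp B
      ((hasFDerivAt_matrix_inv hB).comp B ((hasFDerivAt_id B).add_const (V * Vᴴ)))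
  refine hcomp.congr_fderiv ?_
  ext1 X
  change Vᴴ * -((B + V * Vᴴ)⁻¹ * X * (B + V * Vᴴ)⁻¹) * V = -(Vᴴ * X * V)
  rw [Matrix.mul_neg, Matrix.neg_mul, ← Matrix.mul_assoc Vᴴ, ← Matrix.mul_assoc Vᴴ, hleft,
    Matrix.mul_assoc _ _ V, hright]

theorem isUnit_add_mul_conjTranspose {V : Matrix m κ ℂ} {B : Matrix m m ℂ}
    (hBh : B.IsHermitian) (hV : Vᴴ * V = 1) (hBV : B * V = 0)
    (hrank : Fintype.card m ≤ B.rank + Fintype.card κ) : IsUnit (B + V * Vᴴ) := by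
  have hker : LinearMap.range V.mulVecLin = LinearMap.ker B.mulVecLin := by
    refine Submodule.eq_of_le_of_finrank_le ?_ ?_
    · rw [LinearMap.range_le_ker_iff, ← mulVecLin_mul, hBV, mulVecLin_zero]
    · have hVrank : Fintype.card κ ≤ V.rank := by
        rw [← rank_one (R := ℂ) (n := κ), ← hV]
        exact rank_mul_le_right _ _
      have hBrank := B.mulVecLin.finrank_range_add_finrank_ker
      rw [finrank_fintype_fun_eq_card] at hBrank
      simp only [rank] at hrank hVrank
      lia
  have hVB : Vᴴ * (B + V * Vᴴ) = Vᴴ := by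
    rw [Matrix.mul_add, ← hBh.eq, ← conjTranspose_mul, hBV, conjTranspose_zero, zero_add,
      ← Matrix.mul_assoc, hV, Matrix.one_mul]
  refine mulVec_injective_iff_isUnit.1 ((injective_iff_map_eq_zero (B + V * Vᴴ).mulVecLin).2 ?_)
  intro x hx
  rw [mulVecLin_apply] at hx
  have hVx : Vᴴ *ᵥ x = 0 := by rw [← hVB, ← mulVec_mulVec, hx, mulVec_zero]
  rw [add_mulVec, ← mulVec_mulVec, hVx, mulVec_zero, add_zero] at hx
  obtain ⟨y, rfl⟩ : x ∈ LinearMap.range V.mulVecLin := hker ▸ hx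
  rw [mulVecLin_apply, mulVec_mulVec, hV, one_mulVec] at hVx
  rw [hVx, map_zero]

end CompressedResolvent

section Submersion

variable {E T S F : Type*} [NormedAddCommGroup E] [NormedSpace ℝ E] [NormedAddCommGroup T]
  [NormedSpace ℝ T] [NormedAddCommGroup S] [NormedSpace ℝ S] [NormedAddCommGroup F]
  [NormedSpace ℝ F] {N : WithTop ℕ∞}

theorem eventually_surjective_fderiv [FiniteDimensional ℝ F] {f : E → F} {x : E}
    (hf : ContDiffAt ℝ N f x) (hN : N ≠ 0) (h : Function.Surjective (fderiv ℝ f x)) :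
    ∀ᶠ y in 𝓝 x, Function.Surjective (fderiv ℝ f y) := by
  have : CompleteSpace F := FiniteDimensional.complete ℝ F
  obtain ⟨r, hr⟩ := (fderiv ℝ f x).exists_rightInverse_of_surjective (LinearMap.range_eq_top.2 h)
  have hcont : ContinuousAt (fun y => (fderiv ℝ f y).comp r) x :=
    (hf.continuousAt_fderiv hN).clm_comp continuousAt_const
  have hunit : IsUnit ((fderiv ℝ f x).comp r) := hr ▸ isUnit_one
  filter_upwards [hcont (Units.isOpen.mem_nhds hunit)] with y hy
  have hbij : Function.Bijective (fderiv ℝ f y ∘ r) := ContinuousLinearMap.isUnit_iff_bijective.1 hy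
  exact hbij.2.of_comp

/-- Eliminating `t` from the equation `τ (x, t) = τ p₀` by the implicit function theorem turns the
remaining equation `g (x, t) = 0` into a submersion in `x` alone. -/
theorem exists_submersion_of_implicit [CompleteSpace E] [CompleteSpace T] [CompleteSpace S]
    {τ : E × T → S} {g : E × T → F} {p₀ : E × T} (hN : N ≠ 0) (hτ : ContDiffAt ℝ N τ p₀)
    (hg : ContDiffAt ℝ N g p₀) (hτT : (fderiv ℝ τ p₀ ∘L .inr ℝ E T).IsInvertible)
    (hgT : fderiv ℝ g p₀ ∘L .inr ℝ E T = 0)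
    (hgE : Function.Surjective (fderiv ℝ g p₀ ∘L .inl ℝ E T)) {P : E × T → Prop}
    (hP : ∀ᶠ p in 𝓝 p₀, P p ↔ τ p = τ p₀ ∧ g p = 0) :
    ∃ f : E → F, ContDiffAt ℝ N f p₀.1 ∧ Function.Surjective (fderiv ℝ f p₀.1) ∧
      ∃ W, IsOpen W ∧ p₀.2 ∈ W ∧ ∀ᶠ x in 𝓝 p₀.1, (∃ t ∈ W, P (x, t)) ↔ f x = 0 := by
  let ψ : E → T := hτ.implicitFunction hN hτT
  have hψ : ContDiffAt ℝ N ψ p₀.1 := hτ.contDiffAt_implicitFunction hN hτT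
  have hψp₀ : (p₀.1, ψ p₀.1) = p₀ := Prod.ext rfl (hτ.implicitFunction_apply_self hN hτT)
  have hgraph : ContDiffAt ℝ N (fun x => (x, ψ x)) p₀.1 := contDiffAt_id.prodMk hψ
  have hg' : ContDiffAt ℝ N g (p₀.1, ψ p₀.1) := hψp₀.symm ▸ hg
  refine ⟨fun x => g (x, ψ x), hg'.comp p₀.1 hgraph, ?_, ?_⟩
  · have hderiv : fderiv ℝ (fun x => g (x, ψ x)) p₀.1 = fderiv ℝ g p₀ ∘L .inl ℝ E T := by
      refine ((hg'.differentiableAt hN).hasFDerivAt.comp p₀.1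
        ((hasFDerivAt_id p₀.1).prodMk (hψ.differentiableAt hN).hasFDerivAt)).fderiv.trans ?_
      rw [hψp₀]
      ext1 X
      have hsnd : fderiv ℝ g p₀ (0, fderiv ℝ ψ p₀.1 X) = 0 := DFunLike.congr_fun hgT _
      change fderiv ℝ g p₀ (X, fderiv ℝ ψ p₀.1 X) = fderiv ℝ g p₀ (X, 0)
      rw [← add_zero (fderiv ℝ g p₀ (X, 0)), ← hsnd, ← map_add, Prod.mk_add_mk, add_zero, zero_add]
    rwa [hderiv]
  · have hiff : ∀ᶠ p in 𝓝 p₀, P p ↔ ψ p.1 = p.2 ∧ g p = 0 := by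
      filter_upwards [hP, hτ.eventually_apply_eq_iff_implicitFunction hN hτT] with p hPp hψp
      rw [hPp, hψp]
    obtain ⟨U, W, hU, hxU, hW, htW, hUW⟩ := mem_nhds_prod_iff'.1 hiff
    have hψW : ψ p₀.1 ∈ W := by
      rwa [show ψ p₀.1 = p₀.2 from hτ.implicitFunction_apply_self hN hτT]
    refine ⟨W, hW, htW, ?_⟩
    filter_upwards [hU.mem_nhds hxU, hψ.continuousAt (hW.mem_nhds hψW)] with x hx hψx
    constructor
    · rintro ⟨t, ht, hPt⟩
      obtain ⟨hψt : ψ x = t, hgt⟩ := (hUW (Set.mk_mem_prod hx ht)).1 hPt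
      rwa [hψt]
    · exact fun hgx => ⟨ψ x, hψx, (hUW (Set.mk_mem_prod hx hψx)).2 ⟨rfl, hgx⟩⟩

end Submersion

section DoubleEigenvalue

/-- The real coordinates of the trace-free part of a Hermitian `2 × 2` matrix. -/
noncomputable def blochVector : Matrix (Fin 2) (Fin 2) ℂ →L[ℝ] EuclideanSpace ℝ (Fin 3) :=
  LinearMap.toContinuousLinearMap
    { toFun := fun H => !₂[(H 0 1).re, (H 0 1).im, (H 0 0).re - (H 1 1).re]
      map_add' := fun H K => by
        ext i
        fin_cases i <;> simp
        ring
      map_smul' := fun c H => by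
        ext i
        fin_cases i <;> simp
        ring }

theorem blochVector_apply (H : Matrix (Fin 2) (Fin 2) ℂ) :
    blochVector H = !₂[(H 0 1).re, (H 0 1).im, (H 0 0).re - (H 1 1).re] := rfl

theorem blochVector_one : blochVector 1 = 0 := by
  ext i
  fin_cases i <;> simp [blochVector_apply]

theorem eq_one_iff_trace_blochVector {H : Matrix (Fin 2) (Fin 2) ℂ} (hH : H.IsHermitian) :
    H = 1 ↔ H.trace.re = 2 ∧ blochVector H = 0 := by
  constructor
  · rintro rfl
    exact ⟨by simp, blochVector_one⟩
  · rintro ⟨htr, hbl⟩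
    rw [trace_fin_two, Complex.add_re] at htr
    have h0 : (H 0 1).re = 0 := congrFun (congrArg WithLp.ofLp hbl) 0
    have h1 : (H 0 1).im = 0 := congrFun (congrArg WithLp.ofLp hbl) 1
    have h2 : (H 0 0).re - (H 1 1).re = 0 := congrFun (congrArg WithLp.ofLp hbl) 2
    have h01 : H 0 1 = 0 := Complex.ext h0 h1
    have h10 : H 1 0 = 0 := by rw [← hH.apply, h01, star_zero]
    have hdiag : ∀ i, (H i i).re = 1 → H i i = 1 := fun i hi => by
      rw [← hH.coe_re_apply_self i]
      simp [hi]
    ext i j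
    fin_cases i <;> fin_cases j
    · exact hdiag 0 (by linarith)
    · exact h01
    · exact h10
    · exact hdiag 1 (by linarith)

variable {n k : ℕ}

/-- The affine pencil `(A, s) ↦ A - s` of banded Hermitian matrices. -/
noncomputable def bandShift (n k : ℕ) : bandHerm n k × ℝ →L[ℝ] Matrix (Fin n) (Fin n) ℂ :=
  LinearMap.toContinuousLinearMap
    ((bandHerm n k).subtype ∘ₗ LinearMap.fst ℝ _ _ -
      LinearMap.toSpanSingleton ℝ _ (1 : Matrix (Fin n) (Fin n) ℂ) ∘ₗ LinearMap.snd ℝ _ _)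

theorem bandShift_apply (p : bandHerm n k × ℝ) : bandShift n k p = p.1.1 - p.2 • 1 := rfl

theorem isHermitian_bandShift (p : bandHerm n k × ℝ) : (bandShift n k p).IsHermitian :=
  (mem_bandHerm.1 (sub_smul_one_mem_bandHerm p.1.2 p.2)).1

variable {A₀ : bandHerm n k} {s₀ : ℝ} {V : Matrix (Fin n) (Fin 2) ℂ}

theorem mem_derogatorySet_iff {A : bandHerm n k} :
    A ∈ derogatorySet n k ↔ ∃ s : ℝ, (bandShift n k (A, s)).rank + 2 ≤ n :=
  isDerogatory_iff (mem_bandHerm.1 A.2).1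

/-- The compressed resolvent of the pencil `(A, s) ↦ A - s`. -/
noncomputable def pencilResolvent (V : Matrix (Fin n) (Fin 2) ℂ) (p : bandHerm n k × ℝ) :
    Matrix (Fin 2) (Fin 2) ℂ :=
  compressedResolvent V (bandShift n k p)

theorem contDiffAt_pencilResolvent {p : bandHerm n k × ℝ}
    (hp : IsUnit (bandShift n k p + V * Vᴴ)) : ContDiffAt ℝ ω (pencilResolvent V) p :=
  ((contDiffAt_compressedResolvent hp).restrict_scalars ℝ).comp p
    (bandShift n k).contDiff.contDiffAt

theorem fderiv_clm_pencilResolvent_apply {F : Type*} [NormedAddCommGroup F] [NormedSpace ℝ F]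
    (L : Matrix (Fin 2) (Fin 2) ℂ →L[ℝ] F) {p : bandHerm n k × ℝ} (hV : Vᴴ * V = 1)
    (hpV : bandShift n k p * V = 0) (hp : IsUnit (bandShift n k p + V * Vᴴ))
    (q : bandHerm n k × ℝ) :
    fderiv ℝ (fun p => L (pencilResolvent V p)) p q = L (-(Vᴴ * bandShift n k q * V)) := by
  have hres := (hasFDerivAt_compressedResolvent (isHermitian_bandShift p) hV hpV hp)
  exact DFunLike.congr_fun (L.hasFDerivAt.comp p
    ((hres.restrictScalars ℝ).comp p (bandShift n k).hasFDerivAt)).fderiv q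

theorem fderiv_clm_pencilResolvent_apply_inr {F : Type*} [NormedAddCommGroup F]
    [NormedSpace ℝ F] (L : Matrix (Fin 2) (Fin 2) ℂ →L[ℝ] F) {p : bandHerm n k × ℝ}
    (hV : Vᴴ * V = 1) (hpV : bandShift n k p * V = 0) (hp : IsUnit (bandShift n k p + V * Vᴴ))
    (t : ℝ) : fderiv ℝ (fun p => L (pencilResolvent V p)) p (0, t) = t • L 1 := by
  rw [fderiv_clm_pencilResolvent_apply L hV hpV hp, ← map_smul]
  simp [bandShift_apply, hV]

theorem exists_blochVector_eq (hsurj : Function.Surjective (compression k (V.col 0) (V.col 1)))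
    (c : EuclideanSpace ℝ (Fin 3)) :
    ∃ X : bandHerm n k, blochVector (-(Vᴴ * X.1 * V)) = c := by
  have hentry : ∀ (X : Matrix (Fin n) (Fin n) ℂ) i j,
      (Vᴴ * X * V) i j = star (V.col i) ⬝ᵥ X *ᵥ V.col j := fun X i j => by
    rw [Matrix.mul_assoc]
    rfl
  obtain ⟨X, hX⟩ := hsurj (-c 2, 0, -⟨c 0, c 1⟩)
  simp only [compression_apply, ← hentry, Prod.mk.injEq] at hX
  refine ⟨X, ?_⟩
  ext i
  fin_cases i <;> simp [blochVector_apply, hX]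

theorem eventually_rank_bandShift_add_le_iff {p₀ : bandHerm n k × ℝ}
    (hp₀ : IsUnit (bandShift n k p₀ + V * Vᴴ)) :
    ∀ᶠ p in 𝓝 p₀, (bandShift n k p).rank + 2 ≤ n ↔
      (pencilResolvent V p).trace.re = 2 ∧ blochVector (pencilResolvent V p) = 0 := by
  have hcont : Continuous fun p => (bandShift n k p + V * Vᴴ).det := by fun_prop
  filter_upwards [hcont.continuousAt.eventually_ne ((isUnit_iff_isUnit_det _).1 hp₀).ne_zero]
    with p hp
  have hrank := compressedResolvent_eq_one_iff ((isUnit_iff_isUnit_det _).2 hp.isUnit)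
  rw [Fintype.card_fin, Fintype.card_fin] at hrank
  rw [← hrank, eq_one_iff_trace_blochVector
    (isHermitian_compressedResolvent V (isHermitian_bandShift p)), pencilResolvent]

theorem eventually_mem_of_rank_bandShift_add_le {W : Set ℝ} (hW : IsOpen W)
    (h : ∀ s, (bandShift n k (A₀, s)).rank + 2 ≤ n → s ∈ W) :
    ∀ᶠ A in 𝓝 A₀, ∀ s, (bandShift n k (A, s)).rank + 2 ≤ n → s ∈ W := by
  simp only [bandShift_apply] at h ⊢
  simpa only [Fintype.card_fin] using continuous_subtype_val.continuousAt.eventually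
    (eventually_mem_of_rank_add_le (A₀ := A₀.1) two_pos hW
      (by simpa only [Fintype.card_fin] using h))

theorem exists_submersion_rank_bandShift (hV : Vᴴ * V = 1)
    (hAV : bandShift n k (A₀, s₀) * V = 0) (hrank : n = (bandShift n k (A₀, s₀)).rank + 2)
    (hsurj : Function.Surjective (compression k (V.col 0) (V.col 1))) :
    ∃ f : bandHerm n k → EuclideanSpace ℝ (Fin 3), ContDiffAt ℝ ω f A₀ ∧
      Function.Surjective (fderiv ℝ f A₀) ∧ ∃ W, IsOpen W ∧ s₀ ∈ W ∧
        ∀ᶠ A in 𝓝 A₀, (∃ s ∈ W, (bandShift n k (A, s)).rank + 2 ≤ n) ↔ f A = 0 := by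
  have hunit : IsUnit (bandShift n k (A₀, s₀) + V * Vᴴ) :=
    isUnit_add_mul_conjTranspose (isHermitian_bandShift _) hV hAV (by simp [← hrank])
  have hiff := eventually_rank_bandShift_add_le_iff hunit
  have hG := contDiffAt_pencilResolvent hunit
  let reTrace : Matrix (Fin 2) (Fin 2) ℂ →L[ℝ] ℝ :=
    (Complex.reLm ∘ₗ traceLinearMap (Fin 2) ℝ ℂ).toContinuousLinearMap
  let τ : bandHerm n k × ℝ → ℝ := fun p => reTrace (pencilResolvent V p)
  let g : bandHerm n k × ℝ → EuclideanSpace ℝ (Fin 3) := fun p => blochVector (pencilResolvent V p)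
  have hτT : (fderiv ℝ τ (A₀, s₀) ∘L .inr ℝ (bandHerm n k) ℝ).IsInvertible := by
    refine ⟨ContinuousLinearEquiv.unitsEquivAut ℝ (Units.mk0 2 two_ne_zero), ?_⟩
    ext1
    refine Eq.trans ?_ (fderiv_clm_pencilResolvent_apply_inr reTrace hV hAV hunit 1).symm
    simp [reTrace]
  have hgT : fderiv ℝ g (A₀, s₀) ∘L .inr ℝ (bandHerm n k) ℝ = 0 := by
    ext1
    refine (fderiv_clm_pencilResolvent_apply_inr blochVector hV hAV hunit 1).trans ?_
    rw [blochVector_one, smul_zero]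
    rfl
  have hgE : Function.Surjective (fderiv ℝ g (A₀, s₀) ∘L .inl ℝ (bandHerm n k) ℝ) := fun c => by
    obtain ⟨X, hX⟩ := exists_blochVector_eq hsurj c
    refine ⟨X, (fderiv_clm_pencilResolvent_apply blochVector hV hAV hunit (X, 0)).trans ?_⟩
    rw [bandShift_apply, zero_smul, sub_zero, hX]
  refine exists_submersion_of_implicit (P := fun p => (bandShift n k p).rank + 2 ≤ n) (by simp)
    (reTrace.contDiff.contDiffAt.comp _ hG) (blochVector.contDiff.contDiffAt.comp _ hG)
    hτT hgT hgE ?_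
  have hτ₀ : τ (A₀, s₀) = 2 := (hiff.self_of_nhds.1 hrank.ge).1
  filter_upwards [hiff] with p hp
  rwa [← hτ₀] at hp

theorem exists_submersion_derogatorySet (hV : Vᴴ * V = 1)
    (hAV : bandShift n k (A₀, s₀) * V = 0) (hrank : n = (bandShift n k (A₀, s₀)).rank + 2)
    (hsurj : Function.Surjective (compression k (V.col 0) (V.col 1)))
    (huniq : ∀ s, (bandShift n k (A₀, s)).rank + 2 ≤ n → s = s₀) :
    ∃ f : bandHerm n k → EuclideanSpace ℝ (Fin 3), ContDiffAt ℝ ω f A₀ ∧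
      Function.Surjective (fderiv ℝ f A₀) ∧ ∀ᶠ A in 𝓝 A₀, A ∈ derogatorySet n k ↔ f A = 0 := by
  obtain ⟨f, hf, hf', W, hW, hsW, hfW⟩ := exists_submersion_rank_bandShift hV hAV hrank hsurj
  refine ⟨f, hf, hf', ?_⟩
  filter_upwards [hfW, eventually_mem_of_rank_bandShift_add_le hW fun s hs => huniq s hs ▸ hsW]
    with A hA hAW
  rw [mem_derogatorySet_iff, ← hA]
  exact ⟨fun ⟨s, hs⟩ => ⟨s, hAW s hs, hs⟩, fun ⟨s, _, hs⟩ => ⟨s, hs⟩⟩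

end DoubleEigenvalue

section SmoothLocus

variable {n k : ℕ}

/-- The points near which the derogatory set is the zero set of a submersion to `ℝ³`. -/
def smoothLocus (n k : ℕ) : Set (bandHerm n k) :=
  {A | ∃ U : Set (bandHerm n k), IsOpen U ∧ A ∈ U ∧
    ∃ f : bandHerm n k → EuclideanSpace ℝ (Fin 3), ContDiffOn ℝ ∞ f U ∧
      (∀ y ∈ U, Function.Surjective (fderiv ℝ f y)) ∧ ∀ y ∈ U, y ∈ derogatorySet n k ↔ f y = 0}

theorem isOpen_smoothLocus : IsOpen (smoothLocus n k) := by
  rw [isOpen_iff_mem_nhds]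
  rintro A ⟨U, hU, hA, hf⟩
  exact mem_of_superset (hU.mem_nhds hA) fun B hB => ⟨U, hU, hB, hf⟩

theorem isSmoothSubmanifold_inter_smoothLocus :
    IsSmoothSubmanifold 3 (derogatorySet n k ∩ smoothLocus n k) := by
  rintro A ⟨-, U, hU, hA, f, hf, hsurj, hiff⟩
  refine ⟨U, hU, hA, f, hf, hsurj, ?_⟩
  ext B
  constructor
  · rintro ⟨⟨hB, -⟩, hBU⟩
    exact ⟨hBU, (hiff B hBU).1 hB⟩
  · rintro ⟨hBU, hB⟩
    exact ⟨⟨(hiff B hBU).2 hB, U, hU, hBU, f, hf, hsurj, hiff⟩, hBU⟩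

theorem mem_smoothLocus {A₀ : bandHerm n k} {s₀ : ℝ} {V : Matrix (Fin n) (Fin 2) ℂ}
    (hV : Vᴴ * V = 1) (hAV : bandShift n k (A₀, s₀) * V = 0)
    (hrank : n = (bandShift n k (A₀, s₀)).rank + 2)
    (hsurj : Function.Surjective (compression k (V.col 0) (V.col 1)))
    (huniq : ∀ s, (bandShift n k (A₀, s)).rank + 2 ≤ n → s = s₀) : A₀ ∈ smoothLocus n k := by
  obtain ⟨f, hf, hf', hiff⟩ := exists_submersion_derogatorySet hV hAV hrank hsurj huniq
  have hnhds := (hf.eventually (by simp)).and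
    ((eventually_surjective_fderiv hf (by simp) hf').and hiff)
  obtain ⟨U, hUf, hU, hA₀⟩ := eventually_nhds_iff.1 hnhds
  exact ⟨U, hU, hA₀, f, fun A hA => ((hUf A hA).1.of_le le_top).contDiffWithinAt,
    fun A hA => (hUf A hA).2.1, fun A hA => (hUf A hA).2.2⟩

theorem linearIndependent_col_of_mul_eq_one {m κ : Type*} [Fintype m] [Finite κ] [DecidableEq κ]
    {U : Matrix κ m ℂ} {V : Matrix m κ ℂ} (h : U * V = 1) : LinearIndependent ℂ V.col := by
  have := Fintype.ofFinite κ
  have hinv : Function.LeftInverse (U *ᵥ ·) (V *ᵥ ·) := fun x => by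
    simp only [mulVec_mulVec, h, one_mulVec]
  exact mulVec_injective_iff.1 hinv.injective

theorem linearIndependent_col_pair {V : Matrix (Fin n) (Fin 2) ℂ} (hV : Vᴴ * V = 1) :
    LinearIndependent ℂ ![V.col 0, V.col 1] := by
  convert linearIndependent_col_of_mul_eq_one hV using 1
  ext i
  fin_cases i <;> rfl

theorem mulVec_eq_smul_of_bandShift_mul_eq_zero {A : bandHerm n k} {s : ℝ} {κ : Type*}
    {V : Matrix (Fin n) κ ℂ} (h : bandShift n k (A, s) * V = 0) (a : κ) :
    A.1 *ᵥ V.col a = s • V.col a := by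
  have hcol : (A.1 - s • 1) *ᵥ V.col a = 0 := congrArg (fun M : Matrix (Fin n) κ ℂ => M.col a) h
  rwa [sub_mulVec, smul_mulVec, one_mulVec, sub_eq_zero] at hcol

theorem finrank_bandTangent_add_five_le_of_rank_add_three_le (hk : 0 < k) {A : bandHerm n k}
    {s : ℝ} (h : (bandShift n k (A, s)).rank + 3 ≤ n) :
    finrank ℝ (bandTangent k (A.1 - s • 1) Set.univ) + 5 ≤ finrank ℝ (bandHerm n k) := by
  obtain ⟨V, hV, hBV⟩ := exists_isometry_mul_eq_zero (κ := Fin 3) (B := bandShift n k (A, s))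
    (by simpa using h)
  have hker : ∀ a, (A.1 - s • 1) *ᵥ V.col a = 0 := fun a =>
    congrArg (fun M : Matrix (Fin n) (Fin 3) ℂ => M.col a) hBV
  refine finrank_bandTangent_add_five_le_of_linearIndependent hk
    (sub_smul_one_mem_bandHerm A.2 s) (hker 0) (hker 1) (hker 2) ?_
  convert linearIndependent_col_of_mul_eq_one hV using 1
  ext i
  fin_cases i <;> rfl

theorem diff_smoothLocus_subset (hk : 0 < k) :
    derogatorySet n k \ smoothLocus n k ⊆
      {A : bandHerm n k | ∃ s : ℝ, finrank ℝ (bandTangent k (A.1 - s • 1) Set.univ) + 5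
        ≤ finrank ℝ (bandHerm n k)} ∪
      {A : bandHerm n k | ∃ s t : ℝ, s ≠ t ∧
        (∃ v w, LinearIndependent ℂ ![v, w] ∧ A.1 *ᵥ v = s • v ∧ A.1 *ᵥ w = s • w) ∧
        ∃ v w, A.1 *ᵥ v = t • v ∧ A.1 *ᵥ w = t • w ∧
          Function.Surjective (compression k v w)} := by
  rintro A ⟨hA, hsing⟩
  obtain ⟨s, hs⟩ := mem_derogatorySet_iff.1 hA
  rw [Set.mem_union, or_iff_not_imp_left, Set.mem_ofPred_eq, not_exists]
  intro hlarge
  have hrank : n = (bandShift n k (A, s)).rank + 2 := by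
    have := mt (finrank_bandTangent_add_five_le_of_rank_add_three_le hk) (hlarge s)
    omega
  obtain ⟨V, hV, hAV⟩ := exists_isometry_mul_eq_zero (κ := Fin 2) (B := bandShift n k (A, s))
    (by simpa using hs)
  have heig := mulVec_eq_smul_of_bandShift_mul_eq_zero hAV
  have hker : ∀ a, (A.1 - s • 1) *ᵥ V.col a = 0 := fun a => by
    rw [sub_smul_one_mulVec (heig a), sub_self, zero_smul]
  have hsurj : Function.Surjective (compression k (V.col 0) (V.col 1)) :=
    not_not.1 <| mt (finrank_bandTangent_add_five_le_of_not_surjective hk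
      (sub_smul_one_mem_bandHerm A.2 s) (hker 0) (hker 1) (linearIndependent_col_pair hV))
      (hlarge s)
  obtain ⟨t, ht, hts⟩ : ∃ t, (bandShift n k (A, t)).rank + 2 ≤ n ∧ t ≠ s := by
    by_contra! huniq
    exact hsing (mem_smoothLocus hV hAV hrank hsurj huniq)
  obtain ⟨V', hV', hAV'⟩ := exists_isometry_mul_eq_zero (κ := Fin 2) (B := bandShift n k (A, t))
    (by simpa using ht)
  have heig' := mulVec_eq_smul_of_bandShift_mul_eq_zero hAV'
  exact ⟨t, s, hts, ⟨_, _, linearIndependent_col_pair hV', heig' 0, heig' 1⟩,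
    _, _, heig 0, heig 1, hsurj⟩

section DiagonalFibre

variable {m : Type*} [DecidableEq m] {d : m → ℝ} {i j : m}

theorem diagonal_sub_smul_one (d : m → ℝ) (s : ℝ) :
    diagonal (fun a => (d a : ℂ)) - s • (1 : Matrix m m ℂ)
      = diagonal fun a => ((d a - s : ℝ) : ℂ) := by
  rw [← diagonal_one, ← diagonal_smul, diagonal_sub]
  simp

variable [Fintype m]

theorem rank_diagonal_sub_smul_one_add_card (d : m → ℝ) (s : ℝ) :
    (diagonal (fun a => (d a : ℂ)) - s • (1 : Matrix m m ℂ)).rank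
      + (Finset.univ.filter fun a => d a = s).card = Fintype.card m := by
  rw [diagonal_sub_smul_one, rank_diagonal, Fintype.card_subtype, add_comm]
  simpa [sub_eq_zero] using Finset.card_filter_add_card_filter_not (s := Finset.univ) (d · = s)

theorem rank_diagonal_sub_smul_one_add_two (hij : i ≠ j) (hdij : d i = d j)
    (hinj : ∀ a b, d a = d b → a ≠ b → a = i ∨ a = j) :
    (diagonal (fun a => (d a : ℂ)) - d i • (1 : Matrix m m ℂ)).rank + 2 = Fintype.card m := by
  have hfibre : (Finset.univ.filter fun a => d a = d i) = {i, j} := by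
    ext a
    simp only [Finset.mem_filter, Finset.mem_univ, true_and, Finset.mem_insert,
      Finset.mem_singleton]
    refine ⟨fun ha => or_iff_not_imp_left.2 fun hai => ?_, ?_⟩
    · exact (hinj a i ha hai).resolve_left hai
    · rintro (rfl | rfl)
      exacts [rfl, hdij.symm]
  rw [← rank_diagonal_sub_smul_one_add_card d (d i), hfibre, Finset.card_pair hij]

theorem eq_of_rank_diagonal_sub_smul_one_add_two_le (hdij : d i = d j)
    (hinj : ∀ a b, d a = d b → a ≠ b → a = i ∨ a = j) {s : ℝ}
    (hs : (diagonal (fun a => (d a : ℂ)) - s • (1 : Matrix m m ℂ)).rank + 2 ≤ Fintype.card m) :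
    s = d i := by
  rw [← rank_diagonal_sub_smul_one_add_card d s, Nat.add_le_add_iff_left] at hs
  obtain ⟨a, ha, b, hb, hab⟩ := Finset.one_lt_card.1 hs
  simp only [Finset.mem_filter, Finset.mem_univ, true_and] at ha hb
  rcases hinj a b (ha.trans hb.symm) hab with rfl | rfl
  exacts [ha.symm, ha.symm.trans hdij.symm]

theorem conjTranspose_mul_self_submatrix_one {κ : Type*} [DecidableEq κ] {e : κ → m}
    (he : Function.Injective e) :
    ((1 : Matrix m m ℂ).submatrix id e)ᴴ * (1 : Matrix m m ℂ).submatrix id e = 1 := by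
  rw [conjTranspose_submatrix, conjTranspose_one, ← submatrix_mul _ _ _ _ _ Function.bijective_id,
    Matrix.one_mul, submatrix_one e he]

end DiagonalFibre

theorem surjective_compression_single {i j : Fin n} (hij : i ≠ j)
    (hk : ((j : ℤ) - (i : ℤ)).natAbs ≤ k) :
    Function.Surjective (compression k (Pi.single i 1) (Pi.single j 1)) := by
  rintro ⟨a, b, z⟩
  let X : bandHerm n k := ⟨hermSingle i i (a / 2) + hermSingle j j (b / 2) + hermSingle i j z,
    add_mem (add_mem (hermSingle_mem_bandHerm (by simp) _) (hermSingle_mem_bandHerm (by simp) _))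
      (hermSingle_mem_bandHerm hk _)⟩
  refine ⟨X, ?_⟩
  simp only [compression_apply, X, add_mulVec, dotProduct_add, star_dotProduct_hermSingle_mulVec]
  simp [hij, hij.symm]

theorem diagonal_mem_inter_smoothLocus {d : Fin n → ℝ}
    (hd : diagonal (fun a => (d a : ℂ)) ∈ bandHerm n k) {i j : Fin n} (hij : i ≠ j)
    (hk : ((j : ℤ) - (i : ℤ)).natAbs ≤ k) (hdij : d i = d j)
    (hinj : ∀ a b, d a = d b → a ≠ b → a = i ∨ a = j) :
    (⟨diagonal fun a => (d a : ℂ), hd⟩ : bandHerm n k) ∈ derogatorySet n k ∩ smoothLocus n k := by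
  let A : bandHerm n k := ⟨diagonal fun a => (d a : ℂ), hd⟩
  let V : Matrix (Fin n) (Fin 2) ℂ := (1 : Matrix (Fin n) (Fin n) ℂ).submatrix id ![i, j]
  have hV : Vᴴ * V = 1 := conjTranspose_mul_self_submatrix_one (by simpa using hij)
  have hAV : bandShift n k (A, d i) * V = 0 := by
    rw [bandShift_apply, diagonal_sub_smul_one]
    ext a b
    rw [diagonal_mul, Matrix.zero_apply, mul_eq_zero, or_iff_not_imp_right]
    intro ha
    obtain rfl : a = ![i, j] b := by_contra fun h => ha (one_apply_ne h)
    fin_cases b <;> simp [hdij]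
  have hrank := rank_diagonal_sub_smul_one_add_two hij hdij hinj
  rw [Fintype.card_fin] at hrank
  have huniq : ∀ s, (bandShift n k (A, s)).rank + 2 ≤ n → s = d i := fun s hs =>
    eq_of_rank_diagonal_sub_smul_one_add_two_le hdij hinj (by rwa [Fintype.card_fin])
  have hcol : ∀ b, V.col b = Pi.single (![i, j] b) 1 := fun b =>
    (mulVec_single_one 1 _).symm.trans (one_mulVec _)
  have hsurj : Function.Surjective (compression k (V.col 0) (V.col 1)) := by
    rw [hcol 0, hcol 1]
    exact surjective_compression_single hij hk
  exact ⟨mem_derogatorySet_iff.2 ⟨d i, hrank.le⟩,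
    mem_smoothLocus hV hAV hrank.symm hsurj huniq⟩

theorem nonempty_inter_smoothLocus (hk : 0 < k) (hkn : k < n) :
    (derogatorySet n k ∩ smoothLocus n k).Nonempty := by
  -- With truncated subtraction, the diagonal is `0, 0, 1, …, n - 2`.
  have hd : diagonal (fun a : Fin n => (((a - 1 : ℕ) : ℝ) : ℂ)) ∈ bandHerm n k :=
    diagonal_mem_bandHerm (by ext; simp)
  refine ⟨_, diagonal_mem_inter_smoothLocus hd (i := ⟨0, by omega⟩) (j := ⟨1, by omega⟩) (by simp)
    (by simpa using Nat.one_le_iff_ne_zero.2 hk.ne') (by simp) fun a b hab hne => ?_⟩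
  simp only [Nat.cast_inj, Fin.ext_iff, ne_eq] at hab hne ⊢
  omega

theorem hasCodimension_derogatorySet (hk : 0 < k) (hkn : k < n) :
    HasCodimension (derogatorySet n k) 3 := by
  refine ⟨derogatorySet n k ∩ smoothLocus n k, Set.inter_subset_left,
    nonempty_inter_smoothLocus hk hkn, ⟨smoothLocus n k, isOpen_smoothLocus, rfl⟩,
    isSmoothSubmanifold_inter_smoothLocus, ?_⟩
  rw [Set.sdiff_self_inter]
  have hdim : dimH (derogatorySet n k \ smoothLocus n k) ≤ (finrank ℝ (bandHerm n k) - 4 : ℕ) := by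
    refine (dimH_mono (diff_smoothLocus_subset hk)).trans ?_
    rw [dimH_union]
    exact max_le dimH_finrank_bandTangent_add_five_le dimH_two_double_eigenvalues_le
  have hfour := four_le_finrank_bandHerm hk hkn
  calc dimH (derogatorySet n k \ smoothLocus n k) + (3 : ℕ)
      ≤ ((finrank ℝ (bandHerm n k) - 4 : ℕ) : ENNReal) + (3 : ℕ) := by gcongr
    _ < finrank ℝ (bandHerm n k) := by
      rw [← Nat.cast_add, Nat.cast_lt]; omega

end SmoothLocus

end BandedHermitian

theorem mainTheorem4 (n k : ℕ) (hk : 0 < k) (hkn : k < n) :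
    ((Module.finrank ℝ (BandedHermitian.bandHerm n k) : ℤ) =
        (n : ℤ) * (2 * k + 1) - k * (k + 1)) ∧
      BandedHermitian.HasCodimension (BandedHermitian.derogatorySet n k) 3 ∧
      dimH (BandedHermitian.derogatorySet n k) + 3 =
        Module.finrank ℝ (BandedHermitian.bandHerm n k) := by
  have hcodim := BandedHermitian.hasCodimension_derogatorySet hk hkn
  exact ⟨BandedHermitian.finrank_bandHerm hkn, hcodim, hcodim.dimH_add⟩
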